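/- Let $p>2$, let $N\ge 1$ be an integer, and let $G$ be the star graph obtained by gluing $N$ half-lines $e_1,\dots,e_N\cong[0,\infty)$ at their origins; $v(0)$ denotes the value of a function $v$ on $G$ at the common vertex. Let $H^1_0(G)$ be the space of real continuous functions on $G$ whose restriction to each half-line is in $H^1$, and which, if $N=1$ (when the vertex belongs to only one edge), vanish at the vertex. A solution of the Kirchhoff--ODE system in $G$ is a function $v\in H^1_0(G)$ with $-v''+v=|v|^{p-2}v$ in each open edge and, if $N\ge 2$, with $\sum_{j=1}^N v_j'(0+)=0$, where $v_j'(0+)$ is the outward derivative at the vertex along $e_j$. Let $C_p(G)$ be the best constant in $$\Big(\int_G|v|^p\,dx\Big)^{2/p}\le C_p(G)\int_G\big(|v'|^2+|v|^2\big)\,dx,\qquad v\in H^1_0(G),$$ let $C_p(\mathbb R)$ be the best constant in the same inequality for $v\in H^1(\mathbb R)$, and consider the problem $$\text{(min)}\qquad \inf_{v\in H^1_0(G),\,v\ne 0} F_{G,p}(v),\qquad F_{G,p}(v)=\frac{\int_G(|v'|^2+|v|^2)\,dx}{\big(\int_G|v|^p\,dx\big)^{2/p}} .$$ Let $\bar v(s)=\left(\frac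 p2\right)^{\frac1{p-2}}\left(\cosh\frac{(p-2)s}{2}\right)^{-\frac{2}{p-2}}$. **Theorem.** 1. If $N$ is even, the Kirchhoff--ODE system in $G$ has infinitely many positive solutions. The nonnegative solutions other than $v\equiv0$ are exactly the functions obtained as follows: choose $s\in\mathbb R$ and a partition of the edges into pairs, and in each pair put $x\mapsto\bar v(x+s)$ on one edge and $x\mapsto\bar v(x-s)$ on the other ($x\ge 0$ being the distance to the vertex); in particular they are positive. If $N=2$ all of them are minimisers of (min); if $N>2$ none of them is. 2. If $N=1$, the only solution of the Kirchhoff--ODE system in $G$ is $v\equiv 0$. 3. If $N\ge3$ is odd, there is a unique nonnegative solution $v\not\equiv0$ of the Kirchhoff--ODE system in $G$. It satisfies $v(0)=\bar v(0)$, all its outward derivatives at the vertex are equal to $0$, and it is not a minimiser of (min). 4. If $N\ne2$, the problem (min) has no minimiser. For every $N\ge1$, $0<C_p(G)=C_p(\mathbb R)<\infty$. -/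

import Mathlib

open MeasureTheory Set
open scoped NNReal ContDiff

noncomputable section

namespace KirchhoffStar

/-! ### Sobolev functions of one variable -/

/-- `g` is a weak derivative of `f` on the open set `I`. -/
def HasWeakDeriv (I : Set ℝ) (f g : ℝ → ℝ) : Prop :=
  ∀ φ : ℝ → ℝ, ContDiff ℝ ∞ φ → HasCompactSupport φ → tsupport φ ⊆ I →
    ∫ x in I, f x * deriv φ x = -∫ x in I, g x * φ x

/-- `g` is a square integrable weak derivative of `f` on `I`. -/
def HasL2WeakDeriv (I : Set ℝ) (f g : ℝ → ℝ) : Prop :=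
  MemLp g 2 (volume.restrict I) ∧ HasWeakDeriv I f g

/-- The Sobolev space `H¹(I)`. -/
def MemH1 (I : Set ℝ) (f : ℝ → ℝ) : Prop :=
  MemLp f 2 (volume.restrict I) ∧ ∃ g, HasL2WeakDeriv I f g

open Classical in
/-- The (almost everywhere unique) square integrable weak derivative of `f` on `I`. -/
def weakDeriv (I : Set ℝ) (f : ℝ → ℝ) : ℝ → ℝ :=
  if h : ∃ g, HasL2WeakDeriv I f g then h.choose else 0

theorem MemH1.weakDeriv_spec {I : Set ℝ} {f : ℝ → ℝ} (h : MemH1 I f) :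
    HasL2WeakDeriv I f (weakDeriv I f) := by
  unfold weakDeriv
  rw [dif_pos h.2]
  exact h.2.choose_spec

/-- `∫_I (|f'|² + |f|²) dx`. -/
def energyOn (I : Set ℝ) (f : ℝ → ℝ) : ℝ :=
  ∫ x in I, ((weakDeriv I f x) ^ 2 + (f x) ^ 2)

/-- `∫_I |f|^p dx`. -/
def powerOn (p : ℝ) (I : Set ℝ) (f : ℝ → ℝ) : ℝ :=
  ∫ x in I, |f x| ^ p

/-! ### The line -/

/-- The best constant `C_p(ℝ)` in
`(∫_ℝ |f|^p)^(2/p) ≤ C ∫_ℝ (|f'|² + |f|²)`, `f ∈ H¹(ℝ)`. -/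
def lineConst (p : ℝ) : ℝ :=
  sInf {C : ℝ | ∀ f : ℝ → ℝ, MemH1 univ f →
    (powerOn p univ f) ^ (2 / p) ≤ C * energyOn univ f}

/-- The soliton `v̄`. -/
def soliton (p s : ℝ) : ℝ :=
  (p / 2) ^ (1 / (p - 2)) * (Real.cosh ((p - 2) * s / 2)) ^ (-(2 / (p - 2)))

/-! ### Star graphs -/

/-- Gluing of the origins of `N` closed half-lines. -/
def starSetoid (N : ℕ) : Setoid (Fin N × ℝ≥0) where
  r a b := a = b ∨ (a.2 = 0 ∧ b.2 = 0)
  iseqv :=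
    { refl := fun _ => Or.inl rfl
      symm := by
        rintro a b (h | ⟨h₁, h₂⟩)
        · exact Or.inl h.symm
        · exact Or.inr ⟨h₂, h₁⟩
      trans := by
        rintro a b c (rfl | ⟨h₁, h₂⟩) (rfl | ⟨h₃, h₄⟩)
        · exact Or.inl rfl
        · exact Or.inr ⟨h₃, h₄⟩
        · exact Or.inr ⟨h₁, h₂⟩
        · exact Or.inr ⟨h₁, h₄⟩ }

/-- The star graph: `N` half-lines `[0, ∞)` glued at their origins. -/
def StarGraph (N : ℕ) : Type := Quotient (starSetoid N)

instance (N : ℕ) : TopologicalSpace (StarGraph N) :=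
  inferInstanceAs (TopologicalSpace (Quotient (starSetoid N)))

variable {N : ℕ}

/-- The point of the edge `e` at distance `x` from the vertex. -/
def pt (e : Fin N) (x : ℝ≥0) : StarGraph N := Quotient.mk (starSetoid N) (e, x)

/-- All edges start at the same vertex. -/
theorem pt_zero (e e' : Fin N) : pt e 0 = pt e' 0 :=
  Quotient.sound (s := starSetoid N) (Or.inr ⟨rfl, rfl⟩)

/-- The restriction of `v` to the edge `e`, as a function of the distance `x ≥ 0` to the vertex.
Its values for `x < 0` are irrelevant: it is only ever used on `(0, ∞)` and `[0, ∞)`. -/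
def onEdge (v : StarGraph N → ℝ) (e : Fin N) (x : ℝ) : ℝ := v (pt e x.toNNReal)

/-- The space `H¹₀(G)`: continuous functions on `G` that are `H¹` on each edge and vanish at the
outer vertices, those which belong to only one edge. The vertex of the star is outer exactly if
`N = 1`. -/
def MemH10 (v : StarGraph N → ℝ) : Prop :=
  Continuous v ∧ (∀ e, MemH1 (Ioi 0) (onEdge v e)) ∧ (N = 1 → ∀ e, v (pt e 0) = 0)

/-- `∫_G (|v'|² + |v|²) dx`. -/
def energy (v : StarGraph N → ℝ) : ℝ := ∑ e, energyOn (Ioi 0) (onEdge v e)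

/-- `∫_G |v|^p dx`. -/
def power (p : ℝ) (v : StarGraph N → ℝ) : ℝ := ∑ e, powerOn p (Ioi 0) (onEdge v e)

/-- The functional `F_{G,p}`. -/
def functional (p : ℝ) (v : StarGraph N → ℝ) : ℝ := energy v / (power p v) ^ (2 / p)

/-- The best constant `C_p(G)` in
`(∫_G |v|^p)^(2/p) ≤ C ∫_G (|v'|² + |v|²)`, `v ∈ H¹₀(G)`, for the star graph with `N` edges. -/
def starConst (p : ℝ) (N : ℕ) : ℝ :=
  sInf {C : ℝ | ∀ v : StarGraph N → ℝ, MemH10 v → (power p v) ^ (2 / p) ≤ C * energy v}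

/-- `v` minimises `F_{G,p}` over the nonzero elements of `H¹₀(G)`. -/
def IsMinimiser (p : ℝ) (v : StarGraph N → ℝ) : Prop :=
  MemH10 v ∧ v ≠ 0 ∧
    ∀ w : StarGraph N → ℝ, MemH10 w → w ≠ 0 → functional p v ≤ functional p w

/-- `v ∈ H¹₀(G)` solves `-v'' + v = |v|^(p-2) v` in each (open) edge and satisfies the
Kirchhoff condition at the vertex if this is an inner vertex, i.e. if `N ≠ 1`. -/
def IsSolution (p : ℝ) (v : StarGraph N → ℝ) : Prop :=
  MemH10 v ∧
  (∀ e, ContDiffOn ℝ 2 (onEdge v e) (Ioi 0) ∧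
    ∀ x : ℝ, 0 < x →
      -deriv (deriv (onEdge v e)) x + onEdge v e x = |onEdge v e x| ^ (p - 2) * onEdge v e x) ∧
  (N ≠ 1 → ∃ d : Fin N → ℝ,
    (∀ e, HasDerivWithinAt (onEdge v e) (d e) (Ici 0) 0) ∧ ∑ e, d e = 0)

/-- `v` is obtained by grouping the edges into pairs `{e, σ e}` and putting on the line formed by
each pair the soliton translated by `s` (in one of the two directions), with the same `s` for all
the pairs. -/
def IsPairedSoliton (p : ℝ) (v : StarGraph N → ℝ) : Prop :=
  ∃ (s : ℝ) (σ : Fin N → Fin N), Function.Involutive σ ∧ (∀ e, σ e ≠ e) ∧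
    ∀ e,
      ((∀ x : ℝ≥0, v (pt e x) = soliton p (x + s)) ∧
        (∀ x : ℝ≥0, v (pt (σ e) x) = soliton p (x - s))) ∨
      ((∀ x : ℝ≥0, v (pt e x) = soliton p (x - s)) ∧
        (∀ x : ℝ≥0, v (pt (σ e) x) = soliton p (x + s)))

end KirchhoffStar

end

noncomputable section

namespace KirchhoffStar

open Filter Topology

/-! ### Weak derivatives in one dimension -/

/-! The sharp inequality comes from a calibration. Let M be the height of the soliton, σ(t) = √(t² -
(2/p)|t|^p) the modulus of its slope at height t, and Φ the odd primitive of σ. Scale f so that |f|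
≤ M with the value M attained. Completing the square, ∫(f'² + f²) - (2/p)∫|f|^p = ∫(|f'| - σ(f))² +
2∫σ(f)|f'|, and ∫σ(f)|f'| bounds the variation of Φ∘f. On the edge where M is attained, Φ∘f goes
from Φ(a), with a the vertex value, to Φ(M) and then to 0; on every other edge it goes from Φ(a) to
0. Hence the right side is at least 4Φ(M) + 2(N-2)|Φ(a)| if N ≥ 2, and at least 4Φ(M) if N = 1,
where a = 0. Since 4Φ(M) is the action of the soliton, the weighted AM-GM inequality gives the
scale-invariant bound (`four_calib_le`, `sobolevInf_mul_le`). The line is a star with two edges, so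
it has the same constant.

If N ≠ 2, equality would force a = 0 and |f'| = σ(f) ≤ |f| on the edge of the maximum, so f = 0
there by Grönwall. The inequality is therefore strict, while solitons escaping to infinity along one
edge approach the constant (`exists_minimising_sequence`); no minimiser exists.

For the classification, u'² - u² + (2/p)|u|^p is constant on an edge, and integrable, hence zero
(`IsSolution.deriv_sq`). For u > 0 the substitution w = u^(-(p-2)/2) makes the equation linear, and
w is a multiple of a translated cosh (`exists_eq_soliton`). So each edge of a nonzero nonnegative
solution carries a translated soliton. Continuity at the vertex makes all shifts ±s, and the
Kirchhoff condition says that both signs occur equally often unless s = 0. The parity of N decides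
the rest. -/

theorem locallyIntegrableOn_of_memLp {I : Set ℝ} {f : ℝ → ℝ}
    (hf : MemLp f 2 (volume.restrict I)) : LocallyIntegrableOn f I :=
  locallyIntegrableOn_of_locallyIntegrable_restrict (hf.locallyIntegrable (by norm_num))

theorem integrable_mul_of_test {I : Set ℝ} {f φ : ℝ → ℝ} (hf : MemLp f 2 (volume.restrict I))
    (hφ : Continuous φ) (hc : HasCompactSupport φ) :
    Integrable (fun x => f x * φ x) (volume.restrict I) :=
  hf.integrable_mul (q := 2) (hφ.memLp_of_hasCompactSupport hc)

theorem setIntegral_mul_eq_integral {I : Set ℝ} {f φ : ℝ → ℝ} (hI : tsupport φ ⊆ I) :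
    ∫ x in I, f x * φ x = ∫ x, f x * φ x := by
  refine setIntegral_eq_integral_of_forall_compl_eq_zero fun x hx => ?_
  rw [image_eq_zero_of_notMem_tsupport fun h => hx (hI h), mul_zero]

theorem ae_eq_zero_of_integral_test {I : Set ℝ} (hI : IsOpen I) {f : ℝ → ℝ}
    (hf : LocallyIntegrableOn f I)
    (h : ∀ φ : ℝ → ℝ, ContDiff ℝ ∞ φ → HasCompactSupport φ → tsupport φ ⊆ I →
      ∫ x in I, f x * φ x = 0) :
    f =ᵐ[volume.restrict I] 0 := by
  have := hI.ae_eq_zero_of_integral_contDiff_smul_eq_zero (μ := volume) hf ?_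
  · exact (ae_restrict_iff' hI.measurableSet).2 this
  · intro φ h1 h2 h3
    rw [← h φ h1 h2 h3, setIntegral_mul_eq_integral h3]
    simp only [smul_eq_mul, mul_comm]

theorem HasL2WeakDeriv.ae_unique {I : Set ℝ} (hI : IsOpen I) {f g₁ g₂ : ℝ → ℝ}
    (h₁ : HasL2WeakDeriv I f g₁) (h₂ : HasL2WeakDeriv I f g₂) :
    g₁ =ᵐ[volume.restrict I] g₂ := by
  have := ae_eq_zero_of_integral_test hI (locallyIntegrableOn_of_memLp (h₁.1.sub h₂.1)) ?_
  · filter_upwards [this] with x hx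
    simpa [sub_eq_zero] using hx
  · intro φ a b c
    have e₁ := h₁.2 φ a b c
    have e₂ := h₂.2 φ a b c
    simp only [Pi.sub_apply, sub_mul]
    rw [integral_sub (integrable_mul_of_test h₁.1 a.continuous b)
      (integrable_mul_of_test h₂.1 a.continuous b)]
    linarith

/-- Makes the arbitrary choice in `weakDeriv` harmless: any explicit weak derivative computes the
energy. -/
theorem weakDeriv_ae_eq {I : Set ℝ} (hI : IsOpen I) {f g : ℝ → ℝ} (h : HasL2WeakDeriv I f g) :
    weakDeriv I f =ᵐ[volume.restrict I] g := by
  have hs : HasL2WeakDeriv I f (weakDeriv I f) := by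
    have hex : ∃ g, HasL2WeakDeriv I f g := ⟨g, h⟩
    unfold weakDeriv
    rw [dif_pos hex]
    exact hex.choose_spec
  exact hs.ae_unique hI h

theorem energyOn_eq {I : Set ℝ} (hI : IsOpen I) {f g : ℝ → ℝ} (h : HasL2WeakDeriv I f g) :
    energyOn I f = ∫ x in I, (g x ^ 2 + f x ^ 2) := by
  refine integral_congr_ae ?_
  filter_upwards [weakDeriv_ae_eq hI h] with x hx
  rw [hx]

theorem hasL2WeakDeriv_of_hasDerivAt {I : Set ℝ} {f g : ℝ → ℝ}
    (hf : MemLp f 2 (volume.restrict I)) (hg : MemLp g 2 (volume.restrict I))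
    (h : ∀ x ∈ I, HasDerivAt f (g x) x) : HasL2WeakDeriv I f g := by
  refine ⟨hg, fun φ h1 h2 h3 => ?_⟩
  have h3' : tsupport (deriv φ) ⊆ I := (tsupport_deriv_subset (𝕜 := ℝ) (f := φ)).trans h3
  have key : ∀ {u ψ : ℝ → ℝ}, MemLp u 2 (volume.restrict I) → Continuous ψ →
      HasCompactSupport ψ → tsupport ψ ⊆ I → Integrable (u * ψ) := by
    intro u ψ hu hψ hc hs
    have := integrable_mul_of_test hu hψ hc
    refine (integrableOn_iff_integrable_of_support_subset fun x hx => ?_).1 this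
    refine hs (subset_tsupport _ ?_)
    exact right_ne_zero_of_mul hx
  have h4 : Continuous (deriv φ) := h1.continuous_deriv (by simp)
  rw [setIntegral_mul_eq_integral h3, setIntegral_mul_eq_integral h3']
  refine integral_mul_deriv_eq_deriv_mul_of_integrable (fun x hx => h x (h3 hx))
    (fun x _ => (h1.differentiable (by simp)).differentiableAt.hasDerivAt)
    (key hf h4 h2.deriv h3') (key hg h1.continuous h2 h3) (key hf h1.continuous h2 h3)

/-- Integration by parts for absolutely continuous functions, on an interval large enough to contain
the support of φ. -/
theorem integral_primitive_mul_deriv {g : ℝ → ℝ} (hg : ∀ a b, IntervalIntegrable g volume a b)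
    (c : ℝ) {φ : ℝ → ℝ} (h1 : ContDiff ℝ ∞ φ) (h2 : HasCompactSupport φ) :
    ∫ x, (∫ t in c..x, g t) * deriv φ x = -∫ x, g x * φ x := by
  obtain ⟨R, hR⟩ := h2.isCompact.isBounded.subset_closedBall 0
  -- The interval must also contain the base point c, and φ must vanish at both ends.
  set r := max R |c| + 1 with hr
  have hRr : R < r := lt_of_le_of_lt (le_max_left _ _) (lt_add_one _)
  have hcr : |c| < r := lt_of_le_of_lt (le_max_right _ _) (lt_add_one _)
  have hr0 : 0 < r := lt_of_le_of_lt (abs_nonneg _) hcr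
  have hs : tsupport φ ⊆ Ioo (-r) r := fun x hx => by
    have := hR hx
    rw [Metric.mem_closedBall, dist_zero_right, Real.norm_eq_abs, abs_le] at this
    constructor <;> linarith
  have hs' : tsupport (deriv φ) ⊆ Ioo (-r) r := (tsupport_deriv_subset (𝕜 := ℝ) (f := φ)).trans hs
  have e1 : ∫ x, (∫ t in c..x, g t) * deriv φ x
      = ∫ x in -r..r, (∫ t in c..x, g t) * deriv φ x := by
    refine (intervalIntegral.integral_eq_integral_of_support_subset fun x hx => ?_).symm
    exact Ioo_subset_Ioc_self (hs' (subset_tsupport _ (right_ne_zero_of_mul hx)))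
  have e2 : ∫ x, g x * φ x = ∫ x in -r..r, g x * φ x := by
    refine (intervalIntegral.integral_eq_integral_of_support_subset fun x hx => ?_).symm
    exact Ioo_subset_Ioc_self (hs (subset_tsupport _ (right_ne_zero_of_mul hx)))
  have hz : ∀ x, x ∉ Ioo (-r) r → φ x = 0 := fun x hx =>
    image_eq_zero_of_notMem_tsupport fun h => hx (hs h)
  have hcm : c ∈ uIcc (-r) r := by
    rw [uIcc_of_le (by linarith)]
    exact ⟨(abs_lt.1 hcr).1.le, (abs_lt.1 hcr).2.le⟩
  have hac := (hg (-r) r).absolutelyContinuousOnInterval_intervalIntegral hcm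
  have hφ : AbsolutelyContinuousOnInterval φ (-r) r :=
    ((h1.of_le (by simp)).contDiffOn).absolutelyContinuousOnInterval
  rw [e1, e2, hac.integral_mul_deriv_eq_deriv_mul hφ, hz r (by simp), hz (-r) (by simp)]
  simp only [mul_zero, sub_zero, zero_sub]
  congr 1
  refine intervalIntegral.integral_congr_ae ?_
  filter_upwards [(hg (-r) r).ae_hasDerivAt_integral] with x hx hx'
  rw [(hx (uIoc_subset_uIcc hx') c hcm).deriv]

/-- The primitive vanishes to the left of the support of θ, and to its right because θ has integral
zero. Its support lies in the convex hull of the support of θ and c, hence in the interval I; adding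
c avoids a separate case for empty support. -/
theorem exists_primitive_test {I : Set ℝ} (hI : I.OrdConnected) {c : ℝ} (hc : c ∈ I)
    {θ : ℝ → ℝ} (h1 : ContDiff ℝ ∞ θ) (h2 : HasCompactSupport θ) (h3 : tsupport θ ⊆ I)
    (h0 : ∫ x, θ x = 0) :
    ∃ Θ : ℝ → ℝ, ContDiff ℝ ∞ Θ ∧ HasCompactSupport Θ ∧ tsupport Θ ⊆ I ∧ deriv Θ = θ := by
  have hK : IsCompact (insert c (tsupport θ)) := h2.isCompact.insert c
  obtain ⟨a, ha⟩ := hK.exists_isLeast (insert_nonempty _ _)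
  obtain ⟨b, hb⟩ := hK.exists_isGreatest (insert_nonempty _ _)
  have hKI : insert c (tsupport θ) ⊆ I := insert_subset hc h3
  have hz : ∀ x, x ∉ Icc a b → θ x = 0 := fun x hx => by
    refine image_eq_zero_of_notMem_tsupport fun h => hx ⟨ha.2 ?_, hb.2 ?_⟩ <;>
    exact mem_insert_of_mem _ h
  have hab : a ≤ b := ha.2 hb.1
  have hcont := h1.continuous
  have hint : ∀ u v, IntervalIntegrable θ volume u v := fun u v => hcont.intervalIntegrable u v
  set Θ : ℝ → ℝ := fun x => ∫ t in a..x, θ t with hΘ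
  have hder : ∀ x, HasDerivAt Θ (θ x) x := fun x =>
    intervalIntegral.integral_hasDerivAt_right (hint a x)
      hcont.stronglyMeasurable.stronglyMeasurableAtFilter hcont.continuousAt
  have hd : deriv Θ = θ := funext fun x => (hder x).deriv
  -- The endpoint x = a is included, by continuity, because interval integrals run over intervals
  -- open on the left.
  have hle : ∀ x, x ≤ a → θ x = 0 := by
    have h1 : Iio a ⊆ {t | θ t = 0} := fun t ht => hz t fun h => absurd h.1 (not_le.2 ht)
    have h2 := closure_minimal h1 (isClosed_eq hcont continuous_const)
    rw [closure_Iio] at h2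
    exact h2
  have hsupp : Function.support Θ ⊆ Icc a b := by
    intro x hx
    by_contra hn
    apply hx
    rcases lt_or_ge x a with h | h
    · change ∫ t in a..x, θ t = 0
      rw [intervalIntegral.integral_symm, intervalIntegral.integral_of_le h.le,
        setIntegral_congr_fun (g := fun _ => (0 : ℝ)) measurableSet_Ioc]
      · simp
      · exact fun t ht => hle t ht.2
    · have hbx : b < x := by
        by_contra hbx
        exact hn ⟨h, not_lt.1 hbx⟩
      change ∫ t in a..x, θ t = 0
      rw [intervalIntegral.integral_eq_integral_of_support_subset, h0]
      intro t ht
      have htI : t ∈ Icc a b := by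
        by_contra h'
        exact ht (hz t h')
      refine ⟨lt_of_le_of_ne htI.1 ?_, htI.2.trans hbx.le⟩
      rintro rfl
      exact ht (hle _ le_rfl)
  have hts : tsupport Θ ⊆ Icc a b := closure_minimal hsupp isClosed_Icc
  refine ⟨Θ, ?_, ?_, hts.trans (hI.out (hKI ha.1) (hKI hb.1)), hd⟩
  · rw [contDiff_infty_iff_deriv, hd]
    exact ⟨fun x => (hder x).differentiableAt, h1⟩
  · exact isCompact_Icc.of_isClosed_subset (isClosed_tsupport _) hts

theorem exists_test_integral_eq_one {I : Set ℝ} (hI : IsOpen I) {c : ℝ} (hc : c ∈ I) :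
    ∃ φ : ℝ → ℝ, ContDiff ℝ ∞ φ ∧ HasCompactSupport φ ∧ tsupport φ ⊆ I ∧ ∫ x, φ x = 1 := by
  obtain ⟨φ, h1, h2, h3, h4, h5⟩ := exists_contDiff_tsupport_subset (n := ⊤) (hI.mem_nhds hc)
  have hpos : 0 < ∫ x, φ x := by
    refine h3.continuous.integral_pos_of_hasCompactSupport_nonneg_nonzero h2 ?_ (x := c) ?_
    · intro x
      exact (h4 (mem_range_self x)).1
    · rw [h5]; exact one_ne_zero
  refine ⟨fun x => (∫ x, φ x)⁻¹ * φ x, contDiff_const.mul h3, h2.mul_left, ?_, ?_⟩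
  · exact (tsupport_mul_subset_right).trans h1
  · rw [integral_const_mul, inv_mul_cancel₀ hpos.ne']

/-- A function whose weak derivative vanishes is almost everywhere constant. -/
theorem ae_const_of_weakDeriv_zero {I : Set ℝ} (hI : IsOpen I) (hI' : I.OrdConnected)
    {c : ℝ} (hc : c ∈ I) {h : ℝ → ℝ} (hh : LocallyIntegrableOn h I)
    (hz : ∀ φ : ℝ → ℝ, ContDiff ℝ ∞ φ → HasCompactSupport φ → tsupport φ ⊆ I →
      ∫ x in I, h x * deriv φ x = 0) :
    ∃ C, ∀ᵐ x ∂(volume.restrict I), h x = C := by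
  obtain ⟨φ₀, p1, p2, p3, p4⟩ := exists_test_integral_eq_one hI hc
  have hint : ∀ {φ : ℝ → ℝ}, Continuous φ → HasCompactSupport φ → tsupport φ ⊆ I →
      Integrable (fun x => h x * φ x) (volume.restrict I) := by
    intro φ a1 a2 a3
    have hK : IntegrableOn h (tsupport φ) := hh.integrableOn_compact_subset a3 a2
    have : IntegrableOn (fun x => h x * φ x) (tsupport φ) :=
      hK.mul_continuousOn a1.continuousOn a2
    refine ((integrableOn_iff_integrable_of_support_subset fun x hx => ?_).1 this).integrableOn
    exact subset_tsupport _ (right_ne_zero_of_mul hx)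
  set C := ∫ x in I, h x * φ₀ x with hC
  refine ⟨C, ?_⟩
  have := ae_eq_zero_of_integral_test hI (f := fun x => h x - C)
    (hh.sub (continuous_const.locallyIntegrable.locallyIntegrableOn I)) ?_
  · filter_upwards [this] with x hx
    simpa [sub_eq_zero] using hx
  · intro ψ q1 q2 q3
    set m := ∫ x, ψ x with hm
    have iψ : Integrable ψ := q1.continuous.integrable_of_hasCompactSupport q2
    have iφ : Integrable φ₀ := p1.continuous.integrable_of_hasCompactSupport p2
    -- The du Bois-Reymond argument: removing the multiple mφ₀ makes the integral zero, so the
    -- difference is the derivative of a test function.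
    obtain ⟨Θ, t1, t2, t3, t4⟩ := exists_primitive_test hI' hc (θ := fun x => ψ x - m * φ₀ x)
      (q1.sub (contDiff_const.mul p1)) (q2.sub p2.mul_left)
      ((tsupport_sub ψ (fun x => m * φ₀ x)).trans
        (union_subset q3 (tsupport_mul_subset_right.trans p3)))
      (by rw [integral_sub iψ (iφ.const_mul m), integral_const_mul, p4, mul_one, sub_self])
    have e := hz Θ t1 t2 t3
    rw [t4] at e
    have e' : ∀ x, h x * (ψ x - m * φ₀ x) = h x * ψ x - m * (h x * φ₀ x) := fun x => by ring
    simp only [e'] at e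
    rw [integral_sub (hint q1.continuous q2 q3) ((hint p1.continuous p2 p3).const_mul m),
      integral_const_mul] at e
    have e2 : ∫ x in I, ψ x = m := setIntegral_eq_integral_of_forall_compl_eq_zero fun x hx =>
      image_eq_zero_of_notMem_tsupport fun h => hx (q3 h)
    simp only [sub_mul]
    rw [integral_sub (hint q1.continuous q2 q3) (iψ.integrableOn.const_mul C), integral_const_mul,
      e2]
    linarith

theorem intervalIntegrable_indicator_of_memLp {I : Set ℝ} (hI : MeasurableSet I) {g : ℝ → ℝ}
    (hg : MemLp g 2 (volume.restrict I)) (a b : ℝ) :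
    IntervalIntegrable (I.indicator g) volume a b :=
  intervalIntegrable_iff.2 <|
    ((((memLp_indicator_iff_restrict hI).2 hg).locallyIntegrable
      (by norm_num)).integrableOn_isCompact isCompact_uIcc).mono_set uIoc_subset_uIcc

/-- A function with a square integrable weak derivative is almost everywhere equal to a
primitive of it. -/
theorem HasL2WeakDeriv.exists_ae_eq_primitive {I : Set ℝ} (hI : IsOpen I) (hI' : I.OrdConnected)
    {c : ℝ} (hc : c ∈ I) {f g : ℝ → ℝ} (hf : MemLp f 2 (volume.restrict I))
    (h : HasL2WeakDeriv I f g) :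
    ∃ C, ∀ᵐ x ∂(volume.restrict I), f x = C + ∫ t in c..x, g t := by
  have hg := intervalIntegrable_indicator_of_memLp hI.measurableSet h.1
  set F : ℝ → ℝ := fun x => ∫ t in c..x, I.indicator g t with hF
  have hFc : Continuous F := intervalIntegral.continuous_primitive hg c
  have hz : ∀ φ : ℝ → ℝ, ContDiff ℝ ∞ φ → HasCompactSupport φ → tsupport φ ⊆ I →
      ∫ x in I, (f x - F x) * deriv φ x = 0 := by
    intro φ a1 a2 a3
    have a3' : tsupport (deriv φ) ⊆ I := (tsupport_deriv_subset (𝕜 := ℝ) (f := φ)).trans a3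
    have a4 : Continuous (deriv φ) := a1.continuous_deriv (by simp)
    have e1 := h.2 φ a1 a2 a3
    have e2 := integral_primitive_mul_deriv hg c a1 a2
    have e3 : ∫ x, I.indicator g x * φ x = ∫ x in I, g x * φ x := by
      rw [setIntegral_mul_eq_integral a3]
      refine integral_congr_ae (ae_of_all _ fun x => ?_)
      by_cases hx : x ∈ I
      · simp [hx]
      · simp [image_eq_zero_of_notMem_tsupport fun h => hx (a3 h)]
    rw [← setIntegral_mul_eq_integral a3', e3] at e2
    simp only [sub_mul]
    rw [integral_sub (integrable_mul_of_test hf a4 a2.deriv), e1, e2, sub_self]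
    exact ((hFc.mul a4).integrable_of_hasCompactSupport a2.deriv.mul_left).integrableOn
  obtain ⟨C, hC⟩ := ae_const_of_weakDeriv_zero hI hI' hc
    ((locallyIntegrableOn_of_memLp hf).sub (hFc.locallyIntegrable.locallyIntegrableOn I)) hz
  refine ⟨C, ?_⟩
  filter_upwards [hC, ae_restrict_mem hI.measurableSet] with x hx hxI
  have : F x = ∫ t in c..x, g t := by
    refine intervalIntegral.integral_congr fun t ht => ?_
    exact indicator_of_mem (hI'.uIcc_subset hc hxI ht) g
  rw [Pi.sub_apply] at hx
  linarith

/-! ### Absolutely continuous functions on the half-line -/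

/-- `f` belongs to `H¹(0, ∞)`, is continuous on `[0, ∞)` and has the weak derivative `g`. -/
structure HalfLineH1 (f g : ℝ → ℝ) : Prop where
  memLp : MemLp f 2 (volume.restrict (Ioi 0))
  memLp_deriv : MemLp g 2 (volume.restrict (Ioi 0))
  eq_primitive : ∀ x, 0 ≤ x → f x = f 0 + ∫ t in (0 : ℝ)..x, g t

theorem MemLp.intervalIntegrable_of_nonneg {g : ℝ → ℝ} (hg : MemLp g 2 (volume.restrict (Ioi 0)))
    {a b : ℝ} (ha : 0 ≤ a) (hb : 0 ≤ b) : IntervalIntegrable g volume a b := by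
  refine (intervalIntegrable_indicator_of_memLp measurableSet_Ioi hg a b).congr fun x hx => ?_
  exact indicator_of_mem (lt_of_le_of_lt (le_min ha hb) hx.1 : (0 : ℝ) < x) g

/-- Two continuous functions that agree almost everywhere on (0, ∞) agree there, and also at 0 by
taking closures. The primitive is first based at 1, since the base point must lie in the open
interval. -/
theorem MemH1.halfLineH1 {f : ℝ → ℝ} (h : MemH1 (Ioi 0) f) (hc : ContinuousOn f (Ici 0)) :
    HalfLineH1 f (weakDeriv (Ioi 0) f) := by
  set g := weakDeriv (Ioi 0) f
  obtain ⟨hf, -⟩ := id h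
  have hg := h.weakDeriv_spec
  refine ⟨hf, hg.1, ?_⟩
  obtain ⟨C, hC⟩ := hg.exists_ae_eq_primitive isOpen_Ioi ordConnected_Ioi (c := 1)
    (by simp) hf
  have hii := intervalIntegrable_indicator_of_memLp measurableSet_Ioi hg.1
  set F : ℝ → ℝ := fun x => C + ∫ t in (1 : ℝ)..x, (Ioi 0).indicator g t with hF
  have hFc : Continuous F :=
    continuous_const.add (intervalIntegral.continuous_primitive hii 1)
  have hFe : ∀ x, 0 ≤ x → F x = C + ∫ t in (1 : ℝ)..x, g t := by
    intro x hx
    change C + _ = C + _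
    congr 1
    refine intervalIntegral.integral_congr_ae (ae_of_all _ fun t ht => ?_)
    exact indicator_of_mem (lt_of_le_of_lt (le_min zero_le_one hx) ht.1 : (0 : ℝ) < t) g
  have heq : EqOn f F (Ioi 0) := by
    refine Measure.eqOn_open_of_ae_eq (μ := volume) ?_ isOpen_Ioi (hc.mono Ioi_subset_Ici_self)
      hFc.continuousOn
    filter_upwards [hC, ae_restrict_mem measurableSet_Ioi] with x hx hx0
    rw [hx, hFe x (le_of_lt hx0)]
  have heq' : EqOn f F (Ici 0) := by
    refine heq.of_subset_closure hc hFc.continuousOn Ioi_subset_Ici_self ?_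
    rw [closure_Ioi]
  intro x hx
  rw [heq' hx, heq' (self_mem_Ici : (0 : ℝ) ∈ Ici 0), hFe x hx, hFe 0 le_rfl, add_assoc,
    intervalIntegral.integral_add_adjacent_intervals]
  · exact MemLp.intervalIntegrable_of_nonneg hg.1 zero_le_one le_rfl
  · exact MemLp.intervalIntegrable_of_nonneg hg.1 le_rfl hx

theorem _root_.AbsolutelyContinuousOnInterval.lipschitzOnWith_comp {f Φ : ℝ → ℝ} {a b : ℝ}
    (hf : AbsolutelyContinuousOnInterval f a b) {s : Set ℝ} {K : ℝ≥0}
    (hΦ : LipschitzOnWith K Φ s) (hs : MapsTo f (uIcc a b) s) :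
    AbsolutelyContinuousOnInterval (fun x => Φ (f x)) a b := by
  rw [absolutelyContinuousOnInterval_iff] at hf ⊢
  intro ε hε
  -- K + 1 rather than K, since K may be zero.
  obtain ⟨δ, hδ, h⟩ := hf (ε / (K + 1)) (by positivity)
  refine ⟨δ, hδ, fun E hE hE' => ?_⟩
  calc ∑ i ∈ Finset.range E.1, dist (Φ (f (E.2 i).1)) (Φ (f (E.2 i).2))
      ≤ ∑ i ∈ Finset.range E.1, K * dist (f (E.2 i).1) (f (E.2 i).2) :=
        Finset.sum_le_sum fun i hi =>
          hΦ.dist_le_mul _ (hs (hE.1 i hi).1) _ (hs (hE.1 i hi).2)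
    _ = K * ∑ i ∈ Finset.range E.1, dist (f (E.2 i).1) (f (E.2 i).2) := by
        rw [Finset.mul_sum]
    _ ≤ K * (ε / (K + 1)) := by gcongr; exact (h E hE hE').le
    _ < (K + 1) * (ε / (K + 1)) := by gcongr; linarith
    _ = ε := by field

namespace HalfLineH1

variable {f g : ℝ → ℝ}

theorem intervalIntegrable (h : HalfLineH1 f g) {a b : ℝ} (ha : 0 ≤ a) (hb : 0 ≤ b) :
    IntervalIntegrable g volume a b :=
  MemLp.intervalIntegrable_of_nonneg h.memLp_deriv ha hb

theorem continuousOn (h : HalfLineH1 f g) : ContinuousOn f (Ici 0) := by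
  have hii := intervalIntegrable_indicator_of_memLp measurableSet_Ioi h.memLp_deriv
  have hc : Continuous fun x => f 0 + ∫ t in (0 : ℝ)..x, (Ioi 0).indicator g t :=
    continuous_const.add (intervalIntegral.continuous_primitive hii 0)
  refine hc.continuousOn.congr fun x hx => ?_
  rw [h.eq_primitive x hx]
  congr 1
  refine intervalIntegral.integral_congr_ae (ae_of_all _ fun t ht => ?_)
  exact (indicator_of_mem (lt_of_le_of_lt (le_min le_rfl hx) ht.1 : (0 : ℝ) < t) g).symm

theorem const_mul (h : HalfLineH1 f g) (c : ℝ) :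
    HalfLineH1 (fun x => c * f x) (fun x => c * g x) where
  memLp := h.memLp.const_mul c
  memLp_deriv := h.memLp_deriv.const_mul c
  eq_primitive x hx := by
    rw [intervalIntegral.integral_const_mul, ← mul_add, ← h.eq_primitive x hx]

/-- The chain rule for an absolutely continuous function. -/
theorem comp_sub (h : HalfLineH1 f g) {Φ H : ℝ → ℝ} (hΦ : ∀ t, HasDerivAt Φ (H t) t)
    (hH : Continuous H) {x y : ℝ} (hx : 0 ≤ x) (hy : 0 ≤ y) :
    Φ (f y) - Φ (f x) = ∫ t in x..y, H (f t) * g t := by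
  set F : ℝ → ℝ := fun z => f x + ∫ t in x..z, g t with hF
  have hFf : ∀ z, 0 ≤ z → f z = F z := by
    intro z hz
    rw [hF]
    simp only
    rw [h.eq_primitive z hz, h.eq_primitive x hx, add_assoc,
      intervalIntegral.integral_add_adjacent_intervals (h.intervalIntegrable le_rfl hx)
        (h.intervalIntegrable hx hz)]
  have hsub : uIcc x y ⊆ Ici 0 := fun z hz => (le_min hx hy).trans hz.1
  have hac : AbsolutelyContinuousOnInterval F x y := by
    have h1 := (h.intervalIntegrable hx hy).absolutelyContinuousOnInterval_intervalIntegral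
      (c := x) (by simp)
    have h2 : AbsolutelyContinuousOnInterval (fun _ : ℝ => f x) x y :=
      (contDiff_const.contDiffOn).absolutelyContinuousOnInterval
    exact h2.add h1
  obtain ⟨R, hR⟩ := hac.exists_bound
  have hΦ1 : ContDiff ℝ 1 Φ := by
    rw [contDiff_one_iff_deriv]
    refine ⟨fun t => (hΦ t).differentiableAt, ?_⟩
    rwa [show deriv Φ = H from funext fun t => (hΦ t).deriv]
  -- Φ is only locally Lipschitz, which suffices because F is bounded on the interval.
  obtain ⟨K, hK⟩ := (hΦ1.contDiffOn (s := Icc (-R) R)).exists_lipschitzOnWith (by decide)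
    (convex_Icc _ _) isCompact_Icc
  have hcomp := hac.lipschitzOnWith_comp hK (fun z hz => by
    have := hR z hz
    rw [Real.norm_eq_abs, abs_le] at this
    exact this)
  rw [hFf y hy, hFf x hx, ← hcomp.integral_deriv_eq_sub]
  refine intervalIntegral.integral_congr_ae ?_
  filter_upwards [(h.intervalIntegrable hx hy).ae_hasDerivAt_integral] with z hz hz'
  have hz'' := uIoc_subset_uIcc hz'
  have := (hz hz'' x (by simp)).const_add (f x)
  rw [hFf z (hsub hz'')]
  exact ((hΦ (F z)).comp z this).deriv

/-- The derivative 2fg of f² is integrable, so f² has a limit at infinity; f² is integrable too, so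
the limit is zero. -/
theorem tendsto_zero (h : HalfLineH1 f g) : Tendsto f atTop (𝓝 0) := by
  have hfg : IntegrableOn (fun t => 2 * f t * g t) (Ioi 0) := by
    have := (h.memLp.integrable_mul (q := 2) h.memLp_deriv).const_mul 2
    refine this.congr (ae_of_all _ fun t => ?_)
    simp only [Pi.mul_apply]; ring
  have h1 := intervalIntegral_tendsto_integral_Ioi 0 hfg tendsto_id
  have h2 : Tendsto (fun x => f x ^ 2) atTop (𝓝 (f 0 ^ 2 + ∫ t in Ioi 0, 2 * f t * g t)) := by
    refine (h1.const_add (f 0 ^ 2)).congr' ?_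
    filter_upwards [eventually_ge_atTop 0] with y hy
    have := h.comp_sub (Φ := fun t => t ^ 2) (H := fun t => 2 * t)
      (fun t => by simpa using hasDerivAt_pow 2 t) (by fun_prop) le_rfl hy
    simp only [id] at this ⊢
    linarith
  have h3 : f 0 ^ 2 + ∫ t in Ioi 0, 2 * f t * g t = 0 := by
    refine IntegrableAtFilter.eq_zero_of_tendsto (μ := volume) (f := fun x => f x ^ 2)
      (l := atTop) ⟨Ioi 0, Ioi_mem_atTop 0, h.memLp.integrable_sq⟩ (fun s hs => ?_) h2
    obtain ⟨a, ha⟩ := mem_atTop_sets.1 hs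
    have : volume (Ici a) ≤ volume s := measure_mono fun x hx => ha x hx
    rw [Real.volume_Ici, top_le_iff] at this
    exact this
  rw [h3] at h2
  have h4 := h2.sqrt
  simp only [Real.sqrt_sq_eq_abs, Real.sqrt_zero] at h4
  exact (tendsto_zero_iff_abs_tendsto_zero _).2 h4

theorem exists_bound (h : HalfLineH1 f g) : ∃ B, 0 ≤ B ∧ ∀ x, 0 ≤ x → |f x| ≤ B := by
  have h1 := (h.tendsto_zero.abs).eventually (ge_mem_nhds (show |(0 : ℝ)| < 1 by simp))
  obtain ⟨R, hR⟩ := eventually_atTop.1 h1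
  obtain ⟨C, hC⟩ := isCompact_Icc.exists_bound_of_continuousOn
    (h.continuousOn.mono (Icc_subset_Ici_self : Icc 0 R ⊆ Ici 0))
  refine ⟨max 1 C, by positivity, fun x hx => ?_⟩
  rcases le_total R x with hx' | hx'
  · exact (hR x hx').trans (le_max_left _ _)
  · exact (hC x ⟨hx, hx'⟩).trans (le_max_right _ _)

theorem integrable_rpow (h : HalfLineH1 f g) {p : ℝ} (hp : 2 < p) :
    IntegrableOn (fun x => |f x| ^ p) (Ioi 0) := by
  obtain ⟨B, hB0, hB⟩ := h.exists_bound
  refine (h.memLp.integrable_sq.const_mul (B ^ (p - 2))).mono' ?_ ?_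
  · have hc : Continuous fun t : ℝ => |t| ^ p :=
      continuous_abs.rpow_const fun _ => Or.inr (by linarith)
    exact hc.comp_aestronglyMeasurable h.memLp.1
  · filter_upwards [ae_restrict_mem measurableSet_Ioi] with x hx
    have hx' : |f x| ≤ B := hB x (le_of_lt hx)
    rw [Real.norm_of_nonneg (by positivity), ← sq_abs (f x)]
    rcases (abs_nonneg (f x)).eq_or_lt with h0 | h0
    · rw [← h0, Real.zero_rpow (by linarith)]; simp
    · have : |f x| ^ p = |f x| ^ (p - 2) * |f x| ^ 2 := by
        rw [← Real.rpow_natCast, ← Real.rpow_add h0]; congr 1; push_cast; ring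
      rw [this]
      gcongr

/-- The variation of Φ∘f is bounded below by its increments from 0 to x and from x to infinity,
where Φ∘f tends to Φ(0) = 0. -/
theorem abs_comp_le (h : HalfLineH1 f g) {Φ H : ℝ → ℝ} (hΦ : ∀ t, HasDerivAt Φ (H t) t)
    (hH : Continuous H) (hΦ0 : Φ 0 = 0)
    (hint : IntegrableOn (fun t => H (f t) * g t) (Ioi 0)) {x : ℝ} (hx : 0 ≤ x) :
    |Φ (f x) - Φ (f 0)| + |Φ (f x)| ≤ ∫ t in Ioi 0, |H (f t) * g t| := by
  have hΦc : Continuous Φ := continuous_iff_continuousAt.2 fun t => (hΦ t).continuousAt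
  have hlim : Tendsto (fun y => |Φ (f x) - Φ (f 0)| + |Φ (f y) - Φ (f x)|) atTop
      (𝓝 (|Φ (f x) - Φ (f 0)| + |Φ 0 - Φ (f x)|)) :=
    (((hΦc.tendsto 0).comp h.tendsto_zero).sub_const _).abs.const_add _
  rw [hΦ0, zero_sub, abs_neg] at hlim
  refine le_of_tendsto hlim ?_
  filter_upwards [eventually_ge_atTop x] with y hy
  have hy0 := hx.trans hy
  have hii : ∀ {a b : ℝ}, 0 ≤ a → 0 ≤ b → IntervalIntegrable (fun t => |H (f t) * g t|) volume a b :=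
    fun {a b} ha hb => intervalIntegrable_iff.2 (IntegrableOn.mono_set hint.abs fun t ht =>
      lt_of_le_of_lt (le_min ha hb) ht.1)
  rw [h.comp_sub hΦ hH le_rfl hx, h.comp_sub hΦ hH hx hy0]
  calc _ ≤ (∫ t in (0 : ℝ)..x, |H (f t) * g t|) + ∫ t in x..y, |H (f t) * g t| :=
        add_le_add (intervalIntegral.abs_integral_le_integral_abs hx)
          (intervalIntegral.abs_integral_le_integral_abs hy)
    _ = ∫ t in (0 : ℝ)..y, |H (f t) * g t| :=
        intervalIntegral.integral_add_adjacent_intervals (hii le_rfl hx) (hii hx hy0)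
    _ ≤ ∫ t in Ioi 0, |H (f t) * g t| := by
        rw [intervalIntegral.integral_of_le hy0]
        exact setIntegral_mono_set hint.abs (ae_of_all _ fun _ => abs_nonneg _)
          (LE.le.eventuallyLE fun t ht => ht.1)

/-- Grönwall: |f(x)| is at most the integral F(x) of |f| over [0, x], so exp(-x)F(x) is
nonincreasing from the value 0. -/
theorem eq_zero_of_abs_deriv_le (h : HalfLineH1 f g) (h0 : f 0 = 0)
    (hg : ∀ᵐ x ∂(volume.restrict (Ioi 0)), |g x| ≤ |f x|) {x : ℝ} (hx : 0 ≤ x) : f x = 0 := by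
  set u : ℝ → ℝ := fun t => |f (max t 0)| with hu
  have huc : Continuous u := by
    refine continuous_abs.comp ?_
    exact h.continuousOn.comp_continuous (by fun_prop) fun t => mem_Ici.2 (le_max_right _ _)
  set F : ℝ → ℝ := fun x => ∫ t in (0 : ℝ)..x, u t with hF
  have hd : ∀ x, HasDerivAt F (u x) x := fun x =>
    intervalIntegral.integral_hasDerivAt_right (huc.intervalIntegrable _ _)
      huc.stronglyMeasurable.stronglyMeasurableAtFilter huc.continuousAt
  have hle : ∀ x, 0 ≤ x → u x ≤ F x := by
    intro x hx
    simp only [hu, max_eq_left hx]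
    rw [h.eq_primitive x hx, h0, zero_add]
    refine (intervalIntegral.abs_integral_le_integral_abs hx).trans ?_
    refine intervalIntegral.integral_mono_ae_restrict hx (h.intervalIntegrable le_rfl hx).abs
      (huc.intervalIntegrable _ _) ?_
    have h1 := ae_restrict_of_ae_restrict_of_subset (Ioc_subset_Ioi_self : Ioc 0 x ⊆ Ioi 0) hg
    have h2 : ∀ᵐ t ∂(volume.restrict (Icc 0 x)), |g t| ≤ |f t| := by
      rwa [← restrict_Ioc_eq_restrict_Icc]
    filter_upwards [h2, ae_restrict_mem measurableSet_Icc] with t ht ht'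
    simpa [hu, max_eq_left ht'.1] using ht
  have hanti : AntitoneOn (fun x => Real.exp (-x) * F x) (Ici 0) := by
    have hd' : ∀ x, HasDerivAt (fun x => Real.exp (-x) * F x)
        (Real.exp (-x) * (-1) * F x + Real.exp (-x) * u x) x := fun x =>
      ((hasDerivAt_neg x).exp).mul (hd x)
    refine antitoneOn_of_deriv_nonpos (convex_Ici 0)
      (fun x _ => (hd' x).continuousAt.continuousWithinAt)
      (fun x _ => (hd' x).differentiableAt.differentiableWithinAt) fun x hx => ?_
    rw [interior_Ici] at hx
    rw [(hd' x).deriv]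
    have := mul_le_mul_of_nonneg_left (hle x (le_of_lt hx)) (Real.exp_pos (-x)).le
    linarith
  have h1 := hanti self_mem_Ici hx hx
  have h2 : F 0 = 0 := by simp [hF]
  simp only [h2, mul_zero] at h1
  have h3 : F x ≤ 0 := by
    by_contra hn
    exact absurd h1 (not_le.2 (mul_pos (Real.exp_pos _) (not_le.1 hn)))
  have h4 := hle x hx
  simp only [hu, max_eq_left hx] at h4
  exact abs_eq_zero.1 (le_antisymm (h4.trans h3) (abs_nonneg _))

end HalfLineH1

/-! ### The calibration -/

/-- The modulus of the slope of the soliton, as a function of its height. -/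
def slope (p t : ℝ) : ℝ := √(t ^ 2 - 2 / p * |t| ^ p)

/-- The primitive of `slope p` that vanishes at the origin. -/
def calib (p t : ℝ) : ℝ := ∫ s in (0 : ℝ)..t, slope p s

/-- The height of the soliton. -/
def peak (p : ℝ) : ℝ := (p / 2) ^ (1 / (p - 2))

variable {p : ℝ}

theorem peak_pos (hp : 2 < p) : 0 < peak p := Real.rpow_pos_of_pos (by linarith) _

theorem peak_rpow (hp : 2 < p) : peak p ^ (p - 2) = p / 2 := by
  rw [peak, ← Real.rpow_mul (by linarith), one_div_mul_cancel (by linarith), Real.rpow_one]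

theorem slope_nonneg (t : ℝ) : 0 ≤ slope p t := Real.sqrt_nonneg _

theorem continuous_slope (hp : 2 < p) : Continuous (slope p) := by
  have hc : Continuous fun t : ℝ => |t| ^ p :=
    continuous_abs.rpow_const fun _ => Or.inr (by linarith)
  exact (by fun_prop : Continuous fun t : ℝ => t ^ 2 - 2 / p * |t| ^ p).sqrt

theorem slope_neg (t : ℝ) : slope p (-t) = slope p t := by simp [slope]

theorem slope_le_abs (hp : 2 < p) (t : ℝ) : slope p t ≤ |t| := by
  rw [← Real.sqrt_sq_eq_abs]
  refine Real.sqrt_le_sqrt ?_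
  have : 0 ≤ 2 / p * |t| ^ p := by positivity
  linarith

theorem rpow_eq_sq_mul (hp : 2 < p) {t : ℝ} (ht : 0 ≤ t) : t ^ p = t ^ 2 * t ^ (p - 2) := by
  rcases ht.eq_or_lt with h0 | h0
  · rw [← h0, Real.zero_rpow (by linarith)]; simp
  · rw [← Real.rpow_natCast, ← Real.rpow_add h0]; congr 1; push_cast; ring

theorem sq_sub_eq (hp : 2 < p) (t : ℝ) :
    t ^ 2 - 2 / p * |t| ^ p = t ^ 2 * (1 - 2 / p * |t| ^ (p - 2)) := by
  rw [rpow_eq_sq_mul hp (abs_nonneg t), sq_abs]; ring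

/-- Above the height `peak p` the radicand is negative and `√` returns 0; this is why functions are
scaled to stay below that height. -/
theorem slope_sq (hp : 2 < p) {t : ℝ} (ht : |t| ≤ peak p) :
    slope p t ^ 2 = t ^ 2 - 2 / p * |t| ^ p := by
  rw [slope, Real.sq_sqrt]
  rw [sq_sub_eq hp]
  have h1 : |t| ^ (p - 2) ≤ p / 2 := by
    rw [← peak_rpow hp]
    exact Real.rpow_le_rpow (abs_nonneg t) ht (by linarith)
  have h2 : 2 / p * |t| ^ (p - 2) ≤ 2 / p * (p / 2) := by gcongr
  rw [show 2 / p * (p / 2) = 1 by field_simp] at h2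
  exact mul_nonneg (sq_nonneg _) (by linarith)

theorem slope_pos (hp : 2 < p) {t : ℝ} (h0 : 0 < t) (ht : t < peak p) : 0 < slope p t := by
  refine Real.sqrt_pos.2 ?_
  rw [sq_sub_eq hp, abs_of_pos h0]
  have h1 : t ^ (p - 2) < p / 2 := by
    rw [← peak_rpow hp]
    exact Real.rpow_lt_rpow h0.le ht (by linarith)
  have h2 : 2 / p * t ^ (p - 2) < 2 / p * (p / 2) := by gcongr
  rw [show 2 / p * (p / 2) = 1 by field_simp] at h2
  exact mul_pos (by positivity) (by linarith)

theorem hasDerivAt_calib (hp : 2 < p) (t : ℝ) : HasDerivAt (calib p) (slope p t) t :=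
  have hc := continuous_slope hp
  intervalIntegral.integral_hasDerivAt_right (hc.intervalIntegrable _ _)
    hc.stronglyMeasurable.stronglyMeasurableAtFilter hc.continuousAt

theorem calib_zero : calib p 0 = 0 := by simp [calib]

theorem calib_neg (t : ℝ) : calib p (-t) = -calib p t := by
  unfold calib
  have := intervalIntegral.integral_comp_neg (a := 0) (b := t) (slope p)
  simp only [slope_neg, neg_zero] at this
  rw [intervalIntegral.integral_symm, ← this]

theorem calib_pos (hp : 2 < p) {t : ℝ} (h0 : 0 < t) (ht : t ≤ peak p) : 0 < calib p t :=
  intervalIntegral.intervalIntegral_pos_of_pos_on ((continuous_slope hp).intervalIntegrable _ _)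
    (fun _ hs => slope_pos hp hs.1 (hs.2.trans_le ht)) h0

theorem abs_calib_pos (hp : 2 < p) {t : ℝ} (h0 : t ≠ 0) (ht : |t| ≤ peak p) :
    0 < |calib p t| := by
  have := calib_pos hp (abs_pos.2 h0) ht
  rcases abs_choice t with h | h
  · rw [h] at this; exact abs_pos_of_pos this
  · rw [h, calib_neg] at this; exact abs_pos_of_neg (by linarith)

namespace HalfLineH1

variable {f g : ℝ → ℝ}

theorem memLp_slope (h : HalfLineH1 f g) (hp : 2 < p) :
    MemLp (fun x => slope p (f x)) 2 (volume.restrict (Ioi 0)) :=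
  h.memLp.mono ((continuous_slope hp).comp_aestronglyMeasurable h.memLp.1)
    (ae_of_all _ fun x => by
      rw [Real.norm_of_nonneg (slope_nonneg _)]; exact slope_le_abs hp _)

theorem integrable_slope_mul (h : HalfLineH1 f g) (hp : 2 < p) :
    IntegrableOn (fun x => slope p (f x) * g x) (Ioi 0) :=
  (h.memLp_slope hp).integrable_mul (q := 2) h.memLp_deriv

theorem integrable_energy (h : HalfLineH1 f g) :
    IntegrableOn (fun x => g x ^ 2 + f x ^ 2) (Ioi 0) :=
  h.memLp_deriv.integrable_sq.add h.memLp.integrable_sq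

theorem integrable_defect (h : HalfLineH1 f g) (hp : 2 < p) :
    IntegrableOn (fun x => (|g x| - slope p (f x)) ^ 2) (Ioi 0) :=
  (h.memLp_deriv.norm.sub (h.memLp_slope hp)).integrable_sq

/-- The left integrand is g² + σ(f)² with σ = `slope p`; complete the square. -/
theorem action_eq (h : HalfLineH1 f g) (hp : 2 < p) (hM : ∀ x, 0 ≤ x → |f x| ≤ peak p) :
    (∫ x in Ioi 0, (g x ^ 2 + f x ^ 2)) - 2 / p * ∫ x in Ioi 0, |f x| ^ p =
      (∫ x in Ioi 0, (|g x| - slope p (f x)) ^ 2) + 2 * ∫ x in Ioi 0, |slope p (f x) * g x| := by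
  rw [← integral_const_mul, ← integral_const_mul,
    ← integral_sub h.integrable_energy ((h.integrable_rpow hp).const_mul _),
    ← integral_add (h.integrable_defect hp) ((h.integrable_slope_mul hp).abs.const_mul _)]
  refine setIntegral_congr_fun measurableSet_Ioi fun x hx => ?_
  simp only [abs_mul, abs_of_nonneg (slope_nonneg (p := p) (f x))]
  have := slope_sq hp (hM x (le_of_lt hx))
  have h2 := sq_abs (g x)
  linarith [show (|g x| - slope p (f x)) ^ 2 = |g x| ^ 2 - 2 * (slope p (f x) * |g x|)
    + slope p (f x) ^ 2 by ring]

end HalfLineH1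

/-- The calibration inequality on a star, for functions normalised to have maximum `peak p`. -/
theorem four_calib_le {ι : Type*} [Fintype ι] (hp : 2 < p) {f g : ι → ℝ → ℝ}
    (h : ∀ e, HalfLineH1 (f e) (g e)) {a : ℝ} (h0 : ∀ e, f e 0 = a)
    (h1 : Fintype.card ι = 1 → a = 0) (hM : ∀ e x, 0 ≤ x → |f e x| ≤ peak p)
    {e₀ : ι} {x₀ : ℝ} (hx₀ : 0 ≤ x₀) (hf : f e₀ x₀ = peak p) :
    4 * calib p (peak p) ≤ (∑ e, ∫ x in Ioi 0, (g e x ^ 2 + f e x ^ 2))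
        - 2 / p * ∑ e, ∫ x in Ioi 0, |f e x| ^ p ∧
    (Fintype.card ι ≠ 2 → 4 * calib p (peak p) < (∑ e, ∫ x in Ioi 0, (g e x ^ 2 + f e x ^ 2))
        - 2 / p * ∑ e, ∫ x in Ioi 0, |f e x| ^ p) := by
  classical
  set D : ι → ℝ := fun e => ∫ x in Ioi 0, (|g e x| - slope p (f e x)) ^ 2 with hD
  set T : ι → ℝ := fun e => ∫ x in Ioi 0, |slope p (f e x) * g e x| with hT
  have hsum : (∑ e, ∫ x in Ioi 0, (g e x ^ 2 + f e x ^ 2))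
        - 2 / p * ∑ e, ∫ x in Ioi 0, |f e x| ^ p = (∑ e, D e) + 2 * ∑ e, T e := by
    rw [Finset.mul_sum, Finset.mul_sum, ← Finset.sum_sub_distrib, ← Finset.sum_add_distrib]
    exact Finset.sum_congr rfl fun e _ => (h e).action_eq hp (hM e)
  have hDn : ∀ e, 0 ≤ D e := fun e => integral_nonneg fun x => sq_nonneg _
  have hle : ∀ e {x : ℝ}, 0 ≤ x → |calib p (f e x) - calib p a| + |calib p (f e x)| ≤ T e := by
    intro e x hx
    have := (h e).abs_comp_le (hasDerivAt_calib hp) (continuous_slope hp) calib_zero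
      ((h e).integrable_slope_mul hp) hx
    rwa [h0 e] at this
  have hT0 : ∀ e, |calib p a| ≤ T e := fun e => by
    have := hle e le_rfl
    rwa [h0 e, sub_self, abs_zero, zero_add] at this
  -- On this edge `calib p ∘ f` climbs from the vertex to the maximum and then descends to zero.
  have hTe : 2 * calib p (peak p) - calib p a ≤ T e₀ := by
    have := hle e₀ hx₀
    rw [hf] at this
    have e1 := le_abs_self (calib p (peak p) - calib p a)
    have e2 := le_abs_self (calib p (peak p))
    linarith
  have hcard : 1 ≤ Fintype.card ι := Fintype.card_pos_iff.2 ⟨e₀⟩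
  have hsT : 2 * calib p (peak p) - calib p a + ((Fintype.card ι : ℝ) - 1) * |calib p a|
      ≤ ∑ e, T e := by
    rw [← Finset.add_sum_erase _ _ (Finset.mem_univ e₀)]
    refine add_le_add hTe ?_
    have := Finset.card_nsmul_le_sum (Finset.univ.erase e₀) T _ fun e _ => hT0 e
    rw [nsmul_eq_mul, Finset.card_erase_of_mem (Finset.mem_univ _), Finset.card_univ,
      Nat.cast_sub hcard, Nat.cast_one] at this
    exact this
  have hDs : 0 ≤ ∑ e, D e := Finset.sum_nonneg fun e _ => hDn e
  have hca := le_abs_self (calib p a)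
  -- With n edges, the sum of the T e is at least 2Φ(M) + (n - 2)|Φ(a)|. This is useful only for n ≥
  -- 2; for n = 1 the condition a = 0 replaces it.
  have hlow : 4 * calib p (peak p) ≤ (∑ e, D e) + 2 * ∑ e, T e ∧
      (Fintype.card ι ≠ 2 → a ≠ 0 → 4 * calib p (peak p) < (∑ e, D e) + 2 * ∑ e, T e) := by
    rcases hcard.eq_or_lt with hc | hc
    · rw [h1 hc.symm, calib_zero] at *
      simp only [abs_zero, mul_zero, add_zero, sub_zero] at hsT
      exact ⟨by linarith, fun _ hn => absurd rfl hn⟩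
    · have hc' : (2 : ℝ) ≤ Fintype.card ι := by exact_mod_cast hc
      have hnn : 0 ≤ ((Fintype.card ι : ℝ) - 2) * |calib p a| :=
        mul_nonneg (by linarith) (abs_nonneg _)
      refine ⟨by linarith, fun hne ha => ?_⟩
      have hc3 : (2 : ℝ) < Fintype.card ι := by exact_mod_cast lt_of_le_of_ne hc (Ne.symm hne)
      have hM0 := hM e₀ 0 le_rfl
      rw [h0] at hM0
      have : 0 < ((Fintype.card ι : ℝ) - 2) * |calib p a| :=
        mul_pos (by linarith) (abs_calib_pos hp ha hM0)
      linarith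
  rw [hsum]
  refine ⟨hlow.1, fun hne => lt_of_le_of_ne hlow.1 fun heq => ?_⟩
  -- Equality with n ≠ 2 leaves no room for the vertex term, and then none for the defects D e.
  have ha : a = 0 := by
    by_contra hn
    exact absurd heq (hlow.2 hne hn).ne
  subst ha
  simp only [calib_zero, abs_zero, mul_zero, add_zero, sub_zero] at hsT
  have hDz : ∑ e, D e = 0 := le_antisymm (by linarith) hDs
  have hDe : D e₀ = 0 := (Finset.sum_eq_zero_iff_of_nonneg fun e _ => hDn e).1 hDz e₀
    (Finset.mem_univ _)
  have hae := (integral_eq_zero_iff_of_nonneg (fun x => sq_nonneg _)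
    ((h e₀).integrable_defect hp)).1 hDe
  have := (h e₀).eq_zero_of_abs_deriv_le (h0 e₀) (by
    filter_upwards [hae] with x hx
    have : |g e₀ x| = slope p (f e₀ x) := by
      simpa [sub_eq_zero] using hx
    rw [this]
    exact slope_le_abs hp _) hx₀
  rw [hf] at this
  exact absurd this (peak_pos hp).ne'

/-! ### The soliton -/

/-- The derivative of the soliton. -/
def solitonDeriv (p s : ℝ) : ℝ :=
  -(soliton p s * (Real.sinh ((p - 2) * s / 2) / Real.cosh ((p - 2) * s / 2)))

theorem soliton_zero (p : ℝ) : soliton p 0 = peak p := by simp [soliton, peak]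

theorem soliton_pos (hp : 2 < p) (s : ℝ) : 0 < soliton p s :=
  mul_pos (peak_pos hp) (Real.rpow_pos_of_pos (Real.cosh_pos _) _)

theorem soliton_neg (p s : ℝ) : soliton p (-s) = soliton p s := by
  unfold soliton
  rw [show (p - 2) * -s / 2 = -((p - 2) * s / 2) by ring, Real.cosh_neg]

theorem solitonDeriv_neg (p s : ℝ) : solitonDeriv p (-s) = -solitonDeriv p s := by
  unfold solitonDeriv
  rw [soliton_neg, show (p - 2) * -s / 2 = -((p - 2) * s / 2) by ring, Real.cosh_neg,
    Real.sinh_neg]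
  ring

theorem solitonDeriv_zero (p : ℝ) : solitonDeriv p 0 = 0 := by simp [solitonDeriv]

theorem solitonDeriv_ne_zero (hp : 2 < p) {s : ℝ} (hs : s ≠ 0) : solitonDeriv p s ≠ 0 := by
  refine neg_ne_zero.2 (mul_ne_zero (soliton_pos hp s).ne' (div_ne_zero ?_ (Real.cosh_pos _).ne'))
  rw [Ne, Real.sinh_eq_zero]
  have : p - 2 ≠ 0 := by linarith
  positivity

theorem solitonDeriv_nonpos (hp : 2 < p) {s : ℝ} (hs : 0 ≤ s) : solitonDeriv p s ≤ 0 := by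
  refine neg_nonpos.2 (mul_nonneg (soliton_pos hp s).le (div_nonneg ?_ (Real.cosh_pos _).le))
  exact Real.sinh_nonneg_iff.2 (by have : 0 < p - 2 := by linarith
                                   positivity)

theorem abs_eq_of_soliton_eq (hp : 2 < p) {s t : ℝ} (h : soliton p s = soliton p t) :
    |s| = |t| := by
  have hq : 0 < p - 2 := by linarith
  have h1 := mul_left_cancel₀ (peak_pos hp).ne' h
  have h2 := (Real.rpow_left_inj (Real.cosh_pos _).le (Real.cosh_pos _).le
    (neg_ne_zero.2 (by positivity : (2 / (p - 2)) ≠ 0))).1 h1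
  have h3 : |(p - 2) * s / 2| = |(p - 2) * t / 2| :=
    le_antisymm (Real.cosh_le_cosh.1 h2.le) (Real.cosh_le_cosh.1 h2.ge)
  simp only [abs_div, abs_mul, abs_of_pos hq] at h3
  have h4 : |(2 : ℝ)| = 2 := by norm_num
  rw [h4] at h3
  exact mul_left_cancel₀ hq.ne' (by linarith)

theorem hasDerivAt_soliton (hp : 2 < p) (s : ℝ) :
    HasDerivAt (soliton p) (solitonDeriv p s) s := by
  have hq : p - 2 ≠ 0 := by linarith
  have h1 : HasDerivAt (fun s : ℝ => (p - 2) * s / 2) ((p - 2) / 2) s := by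
    simpa using ((hasDerivAt_id s).const_mul (p - 2)).div_const 2
  have hc := Real.cosh_pos ((p - 2) * s / 2)
  have h2 := ((h1.cosh).rpow_const (p := -(2 / (p - 2))) (Or.inl hc.ne')).const_mul
    ((p / 2) ^ (1 / (p - 2)))
  refine h2.congr_deriv ?_
  rw [solitonDeriv, soliton, Real.rpow_sub_one hc.ne']
  field_simp

theorem soliton_rpow (hp : 2 < p) (s : ℝ) :
    soliton p s ^ (p - 2) = p / 2 / Real.cosh ((p - 2) * s / 2) ^ 2 := by
  have hq : p - 2 ≠ 0 := by linarith
  have hc := Real.cosh_pos ((p - 2) * s / 2)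
  have h1 := peak_rpow hp
  change (peak p * _) ^ (p - 2) = _
  rw [Real.mul_rpow (peak_pos hp).le (Real.rpow_nonneg hc.le _), h1,
    ← Real.rpow_mul hc.le, show -(2 / (p - 2)) * (p - 2) = -(2 : ℕ) by
    push_cast; field_simp, Real.rpow_neg hc.le, Real.rpow_natCast]
  rfl

theorem hasDerivAt_solitonDeriv (hp : 2 < p) (s : ℝ) :
    HasDerivAt (solitonDeriv p) (soliton p s - soliton p s ^ (p - 2) * soliton p s) s := by
  have h1 : HasDerivAt (fun s : ℝ => (p - 2) * s / 2) ((p - 2) / 2) s := by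
    simpa using ((hasDerivAt_id s).const_mul (p - 2)).div_const 2
  have hc := Real.cosh_pos ((p - 2) * s / 2)
  have h2 := ((hasDerivAt_soliton hp s).mul (h1.sinh.div h1.cosh hc.ne')).neg
  refine h2.congr_deriv ?_
  simp only [Pi.div_apply]
  rw [soliton_rpow hp, solitonDeriv]
  have h3 := Real.cosh_sq ((p - 2) * s / 2)
  field_simp
  rw [h3]
  ring

theorem solitonDeriv_sq (hp : 2 < p) (s : ℝ) :
    solitonDeriv p s ^ 2 = soliton p s ^ 2 - 2 / p * soliton p s ^ p := by
  have hc := Real.cosh_pos ((p - 2) * s / 2)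
  rw [rpow_eq_sq_mul hp (soliton_pos hp s).le, soliton_rpow hp, solitonDeriv]
  have h3 := Real.cosh_sq ((p - 2) * s / 2)
  have hp0 : p ≠ 0 := by linarith
  field_simp
  rw [h3]
  ring

/-- The soliton saturates the calibration: its defect |v'| - σ(v) vanishes. -/
theorem slope_soliton (hp : 2 < p) {s : ℝ} (hs : 0 ≤ s) :
    slope p (soliton p s) = -solitonDeriv p s := by
  rw [slope, abs_of_pos (soliton_pos hp s), ← solitonDeriv_sq hp, Real.sqrt_sq_eq_abs,
    abs_of_nonpos (solitonDeriv_nonpos hp hs)]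

theorem abs_solitonDeriv_le (hp : 2 < p) (s : ℝ) : |solitonDeriv p s| ≤ soliton p s := by
  refine abs_le_of_sq_le_sq ?_ (soliton_pos hp s).le
  rw [solitonDeriv_sq hp]
  have := Real.rpow_pos_of_pos (soliton_pos hp s) p
  have : 0 ≤ 2 / p * soliton p s ^ p := by positivity
  linarith

theorem continuous_soliton (hp : 2 < p) : Continuous (soliton p) :=
  continuous_iff_continuousAt.2 fun s => (hasDerivAt_soliton hp s).continuousAt

theorem continuous_solitonDeriv (hp : 2 < p) : Continuous (solitonDeriv p) :=
  continuous_iff_continuousAt.2 fun s => (hasDerivAt_solitonDeriv hp s).continuousAt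

theorem contDiff_soliton (p : ℝ) : ContDiff ℝ 2 (soliton p) := by
  have h : ContDiff ℝ 2 fun s : ℝ => Real.cosh ((p - 2) * s / 2) := by fun_prop
  exact contDiff_const.mul (h.rpow_const_of_ne fun s => (Real.cosh_pos _).ne')

/-- From cosh y ≥ exp(|y|)/2; the exponents (p-2)/2 and 2/(p-2) cancel to leave the rate 1. -/
theorem exists_soliton_le_exp (hp : 2 < p) :
    ∃ C, 0 < C ∧ ∀ s, soliton p s ≤ C * Real.exp (-|s|) := by
  have hq : 0 < p - 2 := by linarith
  refine ⟨peak p * (1 / 2) ^ (-(2 / (p - 2))), mul_pos (peak_pos hp) (by positivity), fun s => ?_⟩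
  rw [mul_assoc]
  refine mul_le_mul_of_nonneg_left ?_ (peak_pos hp).le
  have h1 : 1 / 2 * Real.exp |(p - 2) * s / 2| ≤ Real.cosh ((p - 2) * s / 2) := by
    rw [← Real.cosh_abs, Real.cosh_eq]
    have := Real.exp_pos (-|(p - 2) * s / 2|)
    linarith
  have h2 : Real.cosh ((p - 2) * s / 2) ^ (-(2 / (p - 2))) ≤
      (1 / 2 * Real.exp |(p - 2) * s / 2|) ^ (-(2 / (p - 2))) :=
    Real.rpow_le_rpow_of_nonpos (by positivity) h1 (neg_nonpos.2 (by positivity))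
  refine h2.trans (le_of_eq ?_)
  rw [Real.mul_rpow (by norm_num) (Real.exp_pos _).le, ← Real.exp_mul]
  congr 2
  rw [abs_div, abs_mul, abs_of_pos hq, abs_of_pos (two_pos : (0 : ℝ) < 2)]
  field_simp

theorem integrable_exp_neg_abs : Integrable fun x : ℝ => Real.exp (-|x|) := by
  have h : IntegrableOn (fun x : ℝ => Real.exp (-x)) (Ioi 0) := integrableOn_exp_neg_Ioi 0
  have h1 : IntegrableOn (fun x : ℝ => Real.exp (-|x|)) (Ioi 0) :=
    h.congr_fun (fun x hx => by simp only [abs_of_pos (mem_Ioi.1 hx)]) measurableSet_Ioi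
  have h2 : IntegrableOn (fun x : ℝ => Real.exp (-|x|)) (Iic 0) :=
    (integrableOn_exp_Iic 0).congr_fun
      (fun x hx => by simp only [abs_of_nonpos (mem_Iic.1 hx), neg_neg]) measurableSet_Iic
  rw [← integrableOn_univ, ← Iic_union_Ioi (a := (0 : ℝ))]
  exact h2.union h1

theorem memLp_two_of_le_exp {f : ℝ → ℝ} (hf : AEStronglyMeasurable f) {C : ℝ}
    (h : ∀ x, |f x| ≤ C * Real.exp (-|x|)) : MemLp f 2 := by
  rw [memLp_two_iff_integrable_sq hf]
  refine (integrable_exp_neg_abs.const_mul (C ^ 2)).mono' (hf.pow 2) (ae_of_all _ fun x => ?_)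
  rw [Real.norm_of_nonneg (sq_nonneg _), ← sq_abs]
  have h1 : Real.exp (-|x|) ≤ 1 := Real.exp_le_one_iff.2 (by simp)
  calc |f x| ^ 2 ≤ (C * Real.exp (-|x|)) ^ 2 := by gcongr; exact h x
    _ = C ^ 2 * (Real.exp (-|x|) * Real.exp (-|x|)) := by ring
    _ ≤ C ^ 2 * (Real.exp (-|x|) * 1) := by gcongr
    _ = _ := by ring

theorem memLp_soliton (hp : 2 < p) : MemLp (soliton p) 2 := by
  obtain ⟨C, hC, h⟩ := exists_soliton_le_exp hp
  refine memLp_two_of_le_exp (continuous_soliton hp).aestronglyMeasurable (C := C) fun x => ?_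
  rw [abs_of_pos (soliton_pos hp x)]
  exact h x

theorem memLp_solitonDeriv (hp : 2 < p) : MemLp (solitonDeriv p) 2 :=
  (memLp_soliton hp).mono (continuous_solitonDeriv hp).aestronglyMeasurable
    (ae_of_all _ fun x => by
      rw [Real.norm_of_nonneg (soliton_pos hp x).le]; exact abs_solitonDeriv_le hp x)

theorem tendsto_soliton (hp : 2 < p) : Tendsto (soliton p) atTop (𝓝 0) := by
  obtain ⟨C, hC, h⟩ := exists_soliton_le_exp hp
  have h1 : Tendsto (fun s : ℝ => C * Real.exp (-|s|)) atTop (𝓝 (C * 0)) :=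
    (Real.tendsto_exp_neg_atTop_nhds_zero.comp tendsto_abs_atTop_atTop).const_mul C
  rw [mul_zero] at h1
  exact squeeze_zero (fun s => (soliton_pos hp s).le) h h1

theorem integrable_soliton_rpow (hp : 2 < p) : Integrable fun x => soliton p x ^ p := by
  have h := ((memLp_soliton hp).integrable_sq.sub (memLp_solitonDeriv hp).integrable_sq).const_mul
    (p / 2)
  refine h.congr (ae_of_all _ fun x => ?_)
  have hp0 : p ≠ 0 := by linarith
  simp only [Pi.sub_apply]
  rw [solitonDeriv_sq hp]
  field_simp
  ring

/-- The energy of the soliton on the line. -/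
def solitonEnergy (p : ℝ) : ℝ := ∫ x, (solitonDeriv p x ^ 2 + soliton p x ^ 2)

theorem integrable_solitonEnergy (hp : 2 < p) :
    Integrable fun x => solitonDeriv p x ^ 2 + soliton p x ^ 2 :=
  (memLp_solitonDeriv hp).integrable_sq.add (memLp_soliton hp).integrable_sq

theorem solitonEnergy_pos (hp : 2 < p) : 0 < solitonEnergy p := by
  refine (integral_pos_iff_support_of_nonneg (fun x => by positivity)
    (integrable_solitonEnergy hp)).2 ?_
  have : Function.support (fun x => solitonDeriv p x ^ 2 + soliton p x ^ 2) = univ := by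
    refine eq_univ_of_forall fun x => ?_
    have := soliton_pos hp x
    exact (by positivity : (0 : ℝ) < solitonDeriv p x ^ 2 + soliton p x ^ 2).ne'
  rw [this]
  simp

/-- The Nehari identity, obtained by testing the equation with the soliton itself: (vv')' = v'² + v²
- v^p has integral zero. -/
theorem integral_soliton_rpow (hp : 2 < p) : ∫ x, soliton p x ^ p = solitonEnergy p := by
  have hd : ∀ x, HasDerivAt (fun x => soliton p x * solitonDeriv p x)
      ((solitonDeriv p x ^ 2 + soliton p x ^ 2) - soliton p x ^ p) x := by
    intro x
    refine ((hasDerivAt_soliton hp x).mul (hasDerivAt_solitonDeriv hp x)).congr_deriv ?_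
    rw [rpow_eq_sq_mul hp (soliton_pos hp x).le]
    ring
  have h := integral_eq_zero_of_hasDerivAt_of_integrable hd
    ((integrable_solitonEnergy hp).sub (integrable_soliton_rpow hp))
    ((memLp_soliton hp).integrable_mul (q := 2) (memLp_solitonDeriv hp))
  rw [integral_sub (integrable_solitonEnergy hp) (integrable_soliton_rpow hp)] at h
  rw [solitonEnergy]
  linarith

/-- On the decreasing half, v'² = -σ(v)v' is the derivative of -Φ∘v. -/
theorem integral_solitonDeriv_sq (hp : 2 < p) :
    ∫ x in Ioi 0, solitonDeriv p x ^ 2 = calib p (peak p) := by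
  have hd : ∀ x ∈ Ici (0 : ℝ), HasDerivAt (fun x => -calib p (soliton p x))
      (solitonDeriv p x ^ 2) x := by
    intro x hx
    have := ((hasDerivAt_calib hp (soliton p x)).comp x (hasDerivAt_soliton hp x)).neg
    rw [slope_soliton hp hx] at this
    exact this.congr_deriv (by ring)
  have hc : Continuous (calib p) :=
    continuous_iff_continuousAt.2 fun t => (hasDerivAt_calib hp t).continuousAt
  have ht : Tendsto (fun x => -calib p (soliton p x)) atTop (𝓝 (-calib p 0)) :=
    ((hc.tendsto 0).comp (tendsto_soliton hp)).neg
  rw [integral_Ioi_of_hasDerivAt_of_tendsto' hd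
    (memLp_solitonDeriv hp).integrable_sq.integrableOn ht, soliton_zero, calib_zero]
  ring

/-- Identifies the calibration bound with the action of the soliton, by integrating v'² + v² = 2v'²
+ (2/p)v^p. -/
theorem four_calib_peak (hp : 2 < p) :
    4 * calib p (peak p) = (1 - 2 / p) * solitonEnergy p := by
  have h1 : ∫ x, solitonDeriv p x ^ 2 = 2 * calib p (peak p) := by
    rw [← integral_solitonDeriv_sq hp, ← integral_comp_abs (f := fun x => solitonDeriv p x ^ 2)]
    refine integral_congr_ae (ae_of_all _ fun x => ?_)
    rcases abs_choice x with h | h <;> simp only [h, solitonDeriv_neg, neg_sq]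
  have h2 : ∀ x, solitonDeriv p x ^ 2 + soliton p x ^ 2 =
      2 * solitonDeriv p x ^ 2 + 2 / p * soliton p x ^ p := by
    intro x
    rw [solitonDeriv_sq hp]; ring
  have h3 : solitonEnergy p = 2 * (2 * calib p (peak p)) + 2 / p * solitonEnergy p := by
    nth_rw 1 [solitonEnergy]
    simp only [h2]
    rw [integral_add ((memLp_solitonDeriv hp).integrable_sq.const_mul 2)
      ((integrable_soliton_rpow hp).const_mul _), integral_const_mul, integral_const_mul, h1,
      integral_soliton_rpow hp]
  linarith

variable {N : ℕ}

/-! ### The sharp inequality -/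

theorem HalfLineH1.exists_max {f g : ℝ → ℝ} (h : HalfLineH1 f g) :
    ∃ x, 0 ≤ x ∧ ∀ y, 0 ≤ y → |f y| ≤ |f x| := by
  by_cases hz : ∀ y, 0 ≤ y → f y = 0
  · exact ⟨0, le_rfl, fun y hy => by rw [hz y hy, hz 0 le_rfl]⟩
  · push Not at hz
    obtain ⟨y, hy, hfy⟩ := hz
    obtain ⟨x, hx, hmax⟩ := ContinuousOn.exists_isMaxOn' (f := fun x => |f x|) (s := Ici 0)
      h.continuousOn.abs isClosed_Ici (x₀ := y) hy (by
        have h1 : Tendsto (fun x => |f x|) atTop (𝓝 |0|) := h.tendsto_zero.abs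
        rw [abs_zero] at h1
        have h2 := h1.eventually (ge_mem_nhds (abs_pos.2 hfy))
        obtain ⟨R, hR⟩ := eventually_atTop.1 h2
        rw [eventually_inf_principal]
        filter_upwards [(isCompact_Icc (a := (0 : ℝ)) (b := R)).compl_mem_cocompact] with x hx hx0
        refine hR x ?_
        by_contra hn
        exact hx ⟨hx0, (not_le.1 hn).le⟩)
    exact ⟨x, hx, fun z hz => hmax hz⟩

/-- The infimum of the quotient of the energy and the `L^p` norm squared. -/
def sobolevInf (p : ℝ) : ℝ := solitonEnergy p ^ (1 - 2 / p)

theorem sobolevInf_pos (hp : 2 < p) : 0 < sobolevInf p :=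
  Real.rpow_pos_of_pos (solitonEnergy_pos hp) _

/-- The sharp Sobolev inequality on a star, strict unless the star has two edges. -/
theorem sobolevInf_mul_le {ι : Type*} [Fintype ι] (hp : 2 < p) {f g : ι → ℝ → ℝ}
    (h : ∀ e, HalfLineH1 (f e) (g e)) {a : ℝ} (h0 : ∀ e, f e 0 = a)
    (h1 : Fintype.card ι = 1 → a = 0) (hne : ∃ e x, 0 ≤ x ∧ f e x ≠ 0) :
    sobolevInf p * (∑ e, ∫ x in Ioi 0, |f e x| ^ p) ^ (2 / p) ≤
        ∑ e, ∫ x in Ioi 0, (g e x ^ 2 + f e x ^ 2) ∧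
    (Fintype.card ι ≠ 2 → sobolevInf p * (∑ e, ∫ x in Ioi 0, |f e x| ^ p) ^ (2 / p) <
        ∑ e, ∫ x in Ioi 0, (g e x ^ 2 + f e x ^ 2)) := by
  obtain ⟨e₁, x₁, hx₁, hf₁⟩ := hne
  have : Nonempty ι := ⟨e₁⟩
  choose X hX hmax using fun e => (h e).exists_max
  obtain ⟨e₀, he₀⟩ := Finite.exists_max fun e => |f e (X e)|
  have hmax' : ∀ e x, 0 ≤ x → |f e x| ≤ |f e₀ (X e₀)| := fun e x hx =>
    (hmax e x hx).trans (he₀ e)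
  have hm0 : f e₀ (X e₀) ≠ 0 := by
    intro hz
    have := hmax' e₁ x₁ hx₁
    rw [hz, abs_zero] at this
    exact hf₁ (abs_eq_zero.1 (le_antisymm this (abs_nonneg _)))
  have hpk := peak_pos hp
  -- The scaling factor carries a sign, so that the extremal value becomes +`peak p`.
  set c := peak p / f e₀ (X e₀) with hc
  have hc0 : c ≠ 0 := div_ne_zero hpk.ne' hm0
  have hc2 : 0 < c ^ 2 := by positivity
  set A := ∑ e, ∫ x in Ioi 0, (g e x ^ 2 + f e x ^ 2) with hA
  set B := ∑ e, ∫ x in Ioi 0, |f e x| ^ p with hB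
  have hB0 : 0 ≤ B := Finset.sum_nonneg fun e _ => integral_nonneg fun x => by positivity
  have key := four_calib_le hp (fun e => (h e).const_mul c) (a := c * a)
    (fun e => by rw [h0]) (fun hh => by rw [h1 hh, mul_zero])
    (fun e x hx => by
      rw [abs_mul, hc, abs_div, abs_of_pos hpk, div_mul_eq_mul_div,
        div_le_iff₀ (abs_pos.2 hm0)]
      exact mul_le_mul_of_nonneg_left (hmax' e x hx) hpk.le)
    (hX e₀) (by rw [hc, div_mul_cancel₀ _ hm0])
  have eA : ∑ e, ∫ x in Ioi 0, ((c * g e x) ^ 2 + (c * f e x) ^ 2) = c ^ 2 * A := by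
    rw [hA, Finset.mul_sum]
    refine Finset.sum_congr rfl fun e _ => ?_
    rw [← integral_const_mul]
    congr 1
    ext x
    ring
  have eB : ∑ e, ∫ x in Ioi 0, |c * f e x| ^ p = |c| ^ p * B := by
    rw [hB, Finset.mul_sum]
    refine Finset.sum_congr rfl fun e _ => ?_
    rw [← integral_const_mul]
    congr 1
    ext x
    rw [abs_mul, Real.mul_rpow (abs_nonneg _) (abs_nonneg _)]
  rw [eA, eB, four_calib_peak hp] at key
  have hp0 : 0 < p := by linarith
  have h2p : 2 / p < 1 := by rw [div_lt_one hp0]; exact hp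
  -- The weights are those of the action, (2/p) times the power plus (1 - 2/p) times the soliton
  -- energy; the factor c² then cancels.
  have am := Real.geom_mean_le_arith_mean2_weighted (w₁ := 2 / p) (w₂ := 1 - 2 / p)
    (p₁ := |c| ^ p * B) (p₂ := solitonEnergy p) (by positivity) (by linarith) (by positivity)
    (solitonEnergy_pos hp).le (by ring)
  have hcp : (|c| ^ p * B) ^ (2 / p) = c ^ 2 * B ^ (2 / p) := by
    rw [Real.mul_rpow (by positivity) hB0, ← Real.rpow_mul (abs_nonneg c),
      mul_div_cancel₀ _ hp0.ne', Real.rpow_two, sq_abs]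
  rw [hcp] at am
  change c ^ 2 * B ^ (2 / p) * sobolevInf p ≤ _ at am
  constructor
  · refine le_of_mul_le_mul_left ?_ hc2
    linarith [key.1]
  · intro hcard
    refine lt_of_mul_lt_mul_left ?_ hc2.le
    linarith [key.2 hcard]

/-! ### Functions on star graphs -/

theorem continuous_pt (e : Fin N) : Continuous (pt e : ℝ≥0 → StarGraph N) :=
  continuous_quot_mk.comp (by fun_prop : Continuous fun x : ℝ≥0 => (e, x))

theorem exists_eq_pt (y : StarGraph N) : ∃ e x, y = pt e x := by
  induction y using Quotient.inductionOn with
  | h a => exact ⟨a.1, a.2, rfl⟩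

theorem continuous_onEdge {v : StarGraph N → ℝ} (hv : Continuous v) (e : Fin N) :
    Continuous (onEdge v e) :=
  hv.comp ((continuous_pt e).comp continuous_real_toNNReal)

theorem onEdge_zero (v : StarGraph N → ℝ) (e : Fin N) : onEdge v e 0 = v (pt e 0) := by
  simp [onEdge]

theorem onEdge_coe (v : StarGraph N → ℝ) (e : Fin N) (x : ℝ≥0) : onEdge v e x = v (pt e x) := by
  simp [onEdge]

theorem onEdge_eq {v : StarGraph N → ℝ} {e : Fin N} {F : ℝ → ℝ}
    (h : ∀ x : ℝ≥0, v (pt e x) = F x) {x : ℝ} (hx : 0 ≤ x) : onEdge v e x = F x := by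
  rw [onEdge, h, Real.coe_toNNReal x hx]

theorem ext_onEdge {v w : StarGraph N → ℝ} (h : ∀ e x, 0 ≤ x → onEdge v e x = onEdge w e x) :
    v = w := by
  funext y
  obtain ⟨e, x, rfl⟩ := exists_eq_pt y
  rw [← onEdge_coe v, ← onEdge_coe w, h e x x.2]

theorem exists_onEdge_ne_zero {v : StarGraph N → ℝ} (hv : v ≠ 0) :
    ∃ e x, 0 ≤ x ∧ onEdge v e x ≠ 0 := by
  by_contra hn
  push Not at hn
  exact hv (ext_onEdge fun e x hx => by rw [hn e x hx]; rfl)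

theorem MemH10.halfLineH1 {v : StarGraph N → ℝ} (hv : MemH10 v) (e : Fin N) :
    HalfLineH1 (onEdge v e) (weakDeriv (Ioi 0) (onEdge v e)) :=
  (hv.2.1 e).halfLineH1 (continuous_onEdge hv.1 e).continuousOn

/-- The function on the star with given values on the edges. -/
def glue (F : Fin N → ℝ → ℝ) (hF : ∀ e e', F e 0 = F e' 0) : StarGraph N → ℝ :=
  Quotient.lift (fun a : Fin N × ℝ≥0 => F a.1 a.2) (by
    rintro a b (rfl | ⟨ha, hb⟩)
    · rfl
    · simp only [ha, hb, NNReal.coe_zero]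
      exact hF _ _)

theorem glue_pt (F : Fin N → ℝ → ℝ) (hF : ∀ e e', F e 0 = F e' 0) (e : Fin N) (x : ℝ≥0) :
    glue F hF (pt e x) = F e x := rfl

theorem continuous_of_continuous_edges {v : StarGraph N → ℝ} {F : Fin N → ℝ → ℝ}
    (h : ∀ e (x : ℝ≥0), v (pt e x) = F e x) (hF : ∀ e, Continuous (F e)) : Continuous v := by
  refine isQuotientMap_quot_mk.continuous_iff.2 (continuous_prod_of_discrete_left.2 fun e => ?_)
  refine ((hF e).comp NNReal.continuous_coe).congr fun x => ?_
  exact (h e x).symm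

section EdgeFunctions

variable {v : StarGraph N → ℝ} {e : Fin N} {F G : ℝ → ℝ}

theorem hasL2WeakDeriv_onEdge (h : ∀ x : ℝ≥0, v (pt e x) = F x)
    (hd : ∀ x, HasDerivAt F (G x) x) (hF : MemLp F 2 (volume.restrict (Ioi 0)))
    (hG : MemLp G 2 (volume.restrict (Ioi 0))) :
    MemLp (onEdge v e) 2 (volume.restrict (Ioi 0)) ∧
      HasL2WeakDeriv (Ioi 0) (onEdge v e) G := by
  have h1 : MemLp (onEdge v e) 2 (volume.restrict (Ioi 0)) := by
    refine hF.ae_eq ?_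
    filter_upwards [ae_restrict_mem measurableSet_Ioi] with x hx
    exact (onEdge_eq h (le_of_lt hx)).symm
  refine ⟨h1, hasL2WeakDeriv_of_hasDerivAt h1 hG fun x hx => ?_⟩
  refine (hd x).congr_of_eventuallyEq ?_
  filter_upwards [Ioi_mem_nhds hx] with y hy
  exact onEdge_eq h (le_of_lt hy)

theorem memH1_onEdge (h : ∀ x : ℝ≥0, v (pt e x) = F x)
    (hd : ∀ x, HasDerivAt F (G x) x) (hF : MemLp F 2 (volume.restrict (Ioi 0)))
    (hG : MemLp G 2 (volume.restrict (Ioi 0))) : MemH1 (Ioi 0) (onEdge v e) :=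
  ⟨(hasL2WeakDeriv_onEdge h hd hF hG).1, G, (hasL2WeakDeriv_onEdge h hd hF hG).2⟩

theorem energyOn_onEdge (h : ∀ x : ℝ≥0, v (pt e x) = F x)
    (hd : ∀ x, HasDerivAt F (G x) x) (hF : MemLp F 2 (volume.restrict (Ioi 0)))
    (hG : MemLp G 2 (volume.restrict (Ioi 0))) :
    energyOn (Ioi 0) (onEdge v e) = ∫ x in Ioi 0, (G x ^ 2 + F x ^ 2) := by
  rw [energyOn_eq isOpen_Ioi (hasL2WeakDeriv_onEdge h hd hF hG).2]
  refine setIntegral_congr_fun measurableSet_Ioi fun x hx => ?_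
  simp only [onEdge_eq h (le_of_lt hx)]

theorem powerOn_onEdge (h : ∀ x : ℝ≥0, v (pt e x) = F x) :
    powerOn p (Ioi 0) (onEdge v e) = ∫ x in Ioi 0, |F x| ^ p := by
  refine setIntegral_congr_fun measurableSet_Ioi fun x hx => ?_
  simp only [onEdge_eq h (le_of_lt hx)]

end EdgeFunctions

theorem energy_nonneg (v : StarGraph N → ℝ) : 0 ≤ energy v :=
  Finset.sum_nonneg fun _ _ => integral_nonneg fun _ => by positivity

theorem power_zero (hp : 2 < p) : power p (0 : StarGraph N → ℝ) = 0 := by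
  refine Finset.sum_eq_zero fun e _ => ?_
  rw [powerOn_onEdge (F := fun _ => 0) fun x => rfl]
  simp [Real.zero_rpow (by linarith : p ≠ 0)]

theorem power_pos (hp : 2 < p) {v : StarGraph N → ℝ} (hv : MemH10 v) (hne : v ≠ 0) :
    0 < power p v := by
  obtain ⟨e, x, hx, hvx⟩ := exists_onEdge_ne_zero hne
  have hnn : ∀ e, 0 ≤ powerOn p (Ioi 0) (onEdge v e) := fun e =>
    integral_nonneg fun x => by positivity
  refine Finset.sum_pos' (fun e _ => hnn e) ⟨e, Finset.mem_univ _, ?_⟩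
  refine lt_of_le_of_ne (hnn e) fun h0 => hvx ?_
  have hae := (integral_eq_zero_iff_of_nonneg (fun x => by positivity)
    ((hv.halfLineH1 e).integrable_rpow hp)).1 h0.symm
  have hc := continuous_onEdge hv.1 e
  have heq : EqOn (onEdge v e) (fun _ => 0) (Ioi 0) := by
    refine Measure.eqOn_open_of_ae_eq (μ := volume) ?_ isOpen_Ioi hc.continuousOn
      continuousOn_const
    filter_upwards [hae] with x hx
    by_contra hn
    exact absurd hx (Real.rpow_pos_of_pos (abs_pos.2 hn) p).ne'
  exact heq.of_subset_closure hc.continuousOn continuousOn_const Ioi_subset_Ici_self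
    (by rw [closure_Ioi]) hx

theorem MemH10.sobolevInf_mul_le (hp : 2 < p) (hN : 1 ≤ N) {v : StarGraph N → ℝ}
    (hv : MemH10 v) (hne : v ≠ 0) :
    sobolevInf p * power p v ^ (2 / p) ≤ energy v ∧
      (N ≠ 2 → sobolevInf p * power p v ^ (2 / p) < energy v) := by
  have := KirchhoffStar.sobolevInf_mul_le hp hv.halfLineH1 (a := v (pt ⟨0, hN⟩ 0))
    (fun e => by rw [onEdge_zero, pt_zero]) (fun hc => hv.2.2 (by simpa using hc) _)
    (exists_onEdge_ne_zero hne)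
  rw [Fintype.card_fin] at this
  exact this

/-! ### Minimising sequences -/

/-- A translated soliton, corrected so as to vanish at the origin. -/
def trial (p c x : ℝ) : ℝ := soliton p (x - c) - soliton p c * Real.exp (-x)

/-- The derivative of `trial`. -/
def trialDeriv (p c x : ℝ) : ℝ := solitonDeriv p (x - c) + soliton p c * Real.exp (-x)

theorem trial_zero (p c : ℝ) : trial p c 0 = 0 := by
  simp [trial, soliton_neg]

theorem hasDerivAt_trial (hp : 2 < p) (c x : ℝ) :
    HasDerivAt (trial p c) (trialDeriv p c x) x := by
  have h1 := (hasDerivAt_soliton hp (x - c)).comp_sub_const x c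
  refine (h1.sub ((hasDerivAt_neg x).exp.const_mul (soliton p c))).congr_deriv ?_
  rw [trialDeriv]
  ring

theorem continuous_trial (hp : 2 < p) (c : ℝ) : Continuous (trial p c) :=
  continuous_iff_continuousAt.2 fun x => (hasDerivAt_trial hp c x).continuousAt

theorem continuous_trialDeriv (hp : 2 < p) (c : ℝ) : Continuous (trialDeriv p c) := by
  have := continuous_solitonDeriv hp
  unfold trialDeriv
  fun_prop

/-- The bound is uniform in c once recentred at c, so one integrable function dominates all the
trial functions. The correction is controlled by x + c ≥ |x - c|. -/
theorem exists_trial_bound (hp : 2 < p) :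
    ∃ K, 0 < K ∧ ∀ c x, 0 ≤ c → 0 ≤ x → |trial p c x| ≤ K * Real.exp (-|x - c|) ∧
      |trialDeriv p c x| ≤ K * Real.exp (-|x - c|) := by
  obtain ⟨C, hC, h⟩ := exists_soliton_le_exp hp
  refine ⟨2 * C, by positivity, fun c x hc hx => ?_⟩
  have h1 := h (x - c)
  have h2 : soliton p c * Real.exp (-x) ≤ C * Real.exp (-|x - c|) := by
    calc soliton p c * Real.exp (-x) ≤ C * Real.exp (-|c|) * Real.exp (-x) := by
          gcongr; exact h c
      _ = C * Real.exp (-(x + c)) := by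
          rw [mul_assoc, ← Real.exp_add, abs_of_nonneg hc]; ring_nf
      _ ≤ C * Real.exp (-|x - c|) := by
          gcongr
          exact abs_le.2 ⟨by linarith, by linarith⟩
  have h3 := soliton_pos hp (x - c)
  have h4 : 0 < soliton p c * Real.exp (-x) := mul_pos (soliton_pos hp c) (Real.exp_pos _)
  have h5 := abs_le.1 (abs_solitonDeriv_le hp (x - c))
  unfold trial trialDeriv
  exact ⟨abs_le.2 ⟨by linarith, by linarith⟩, abs_le.2 ⟨by linarith, by linarith⟩⟩

theorem memLp_of_exp_bound {f : ℝ → ℝ} (hf : Continuous f) {K c : ℝ}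
    (h : ∀ x, 0 ≤ x → |f x| ≤ K * Real.exp (-|x - c|)) :
    MemLp f 2 (volume.restrict (Ioi 0)) := by
  have h1 : MemLp (fun x => K * Real.exp (-|x|)) 2 := by
    refine memLp_two_of_le_exp (C := |K|) (by fun_prop) fun x => ?_
    rw [abs_mul, Real.abs_exp]
  have h2 : MemLp (fun x => K * Real.exp (-|x - c|)) 2 :=
    h1.comp_measurePreserving (measurePreserving_sub_right volume c)
  refine (h2.restrict (Ioi 0)).mono hf.aestronglyMeasurable ?_
  filter_upwards [ae_restrict_mem measurableSet_Ioi] with x hx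
  exact (h x (le_of_lt hx)).trans (le_abs_self _)

/-- Recentre at n and use dominated convergence. The growth condition, applied with t = exp(-|x|),
gives a dominating function L·exp(-|x|); it covers both the energy and the power. -/
theorem tendsto_integral_trial (hp : 2 < p) {Ψ : ℝ → ℝ → ℝ} (hΨ : Continuous (Function.uncurry Ψ))
    (hb : ∀ K : ℝ, 0 < K → ∃ L, ∀ t u w : ℝ, 0 < t → t ≤ 1 → |u| ≤ K * t → |w| ≤ K * t →
      |Ψ u w| ≤ L * t) :
    Tendsto (fun n : ℕ => ∫ x in Ioi 0, Ψ (trial p n x) (trialDeriv p n x)) atTop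
      (𝓝 (∫ x, Ψ (soliton p x) (solitonDeriv p x))) := by
  obtain ⟨K, hK, hbd⟩ := exists_trial_bound hp
  obtain ⟨L, hL⟩ := hb K hK
  have e : ∀ n : ℕ, ∫ x in Ioi 0, Ψ (trial p n x) (trialDeriv p n x) =
      ∫ x, (Ioi 0).indicator (fun x => Ψ (trial p n x) (trialDeriv p n x)) (x + n) := by
    intro n
    rw [integral_add_right_eq_self
      ((Ioi 0).indicator (fun x => Ψ (trial p n x) (trialDeriv p n x))) (n : ℝ),
      integral_indicator measurableSet_Ioi]
  simp only [e]
  refine tendsto_integral_of_dominated_convergence (fun x => |L| * Real.exp (-|x|)) ?_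
    (integrable_exp_neg_abs.const_mul _) ?_ ?_
  · intro n
    have hc : Continuous fun x => Ψ (trial p n x) (trialDeriv p n x) :=
      hΨ.comp ((continuous_trial hp n).prodMk (continuous_trialDeriv hp n))
    exact ((hc.stronglyMeasurable.indicator measurableSet_Ioi).comp_measurable
      (measurable_id.add_const (n : ℝ))).aestronglyMeasurable
  · intro n
    refine ae_of_all _ fun x => ?_
    by_cases hx : x + n ∈ Ioi (0 : ℝ)
    · rw [indicator_of_mem hx, Real.norm_eq_abs]
      have h1 := hbd n (x + n) (Nat.cast_nonneg n) (le_of_lt hx)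
      rw [add_sub_cancel_right] at h1
      refine (hL _ _ _ (Real.exp_pos _) (Real.exp_le_one_iff.2 (by simp)) h1.1 h1.2).trans ?_
      gcongr
      exact le_abs_self L
    · rw [indicator_of_notMem hx, norm_zero]
      positivity
  · refine ae_of_all _ fun x => ?_
    have hn : Tendsto (fun n : ℕ => (n : ℝ)) atTop atTop := tendsto_natCast_atTop_atTop
    have h1 : Tendsto (fun n : ℕ => soliton p n * Real.exp (-(x + n))) atTop (𝓝 (0 * 0)) :=
      ((tendsto_soliton hp).comp hn).mul
        (Real.tendsto_exp_neg_atTop_nhds_zero.comp (tendsto_const_nhds.add_atTop hn))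
    rw [mul_zero] at h1
    have h2 : Tendsto (fun n : ℕ => trial p n (x + n)) atTop (𝓝 (soliton p x)) := by
      simpa [trial] using h1.const_sub (soliton p x)
    have h3 : Tendsto (fun n : ℕ => trialDeriv p n (x + n)) atTop (𝓝 (solitonDeriv p x)) := by
      simpa [trialDeriv] using h1.const_add (solitonDeriv p x)
    have h4 := (hΨ.tendsto (soliton p x, solitonDeriv p x)).comp (h2.prodMk_nhds h3)
    refine h4.congr' ?_
    filter_upwards [hn.eventually_gt_atTop (-x)] with n hxn
    have : x + n ∈ Ioi (0 : ℝ) := by rw [mem_Ioi]; linarith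
    rw [indicator_of_mem this]
    rfl

theorem tendsto_energy_trial (hp : 2 < p) :
    Tendsto (fun n : ℕ => ∫ x in Ioi 0, (trialDeriv p n x ^ 2 + trial p n x ^ 2)) atTop
      (𝓝 (solitonEnergy p)) := by
  refine tendsto_integral_trial hp (Ψ := fun u w => w ^ 2 + u ^ 2) (by fun_prop) fun K hK => ?_
  refine ⟨2 * K ^ 2, fun t u w ht ht1 hu hw => ?_⟩
  rw [abs_of_nonneg (by positivity), ← sq_abs u, ← sq_abs w]
  have h1 : |u| ^ 2 ≤ (K * t) ^ 2 := by gcongr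
  have h2 : |w| ^ 2 ≤ (K * t) ^ 2 := by gcongr
  have h3 : (K * t) ^ 2 ≤ K ^ 2 * t := by
    rw [mul_pow]
    gcongr
    exact pow_le_of_le_one ht.le ht1 two_ne_zero
  linarith

theorem tendsto_power_trial (hp : 2 < p) :
    Tendsto (fun n : ℕ => ∫ x in Ioi 0, |trial p n x| ^ p) atTop (𝓝 (solitonEnergy p)) := by
  rw [← integral_soliton_rpow hp]
  have hc : Continuous fun u : ℝ => |u| ^ p :=
    continuous_abs.rpow_const fun _ => Or.inr (by linarith)
  have h := tendsto_integral_trial hp (Ψ := fun u _ => |u| ^ p) (hc.comp continuous_fst)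
    fun K hK => ⟨K ^ p, fun t u w ht ht1 hu hw => by
      rw [abs_of_nonneg (by positivity)]
      calc |u| ^ p ≤ (K * t) ^ p := by gcongr
        _ = K ^ p * t ^ p := Real.mul_rpow hK.le ht.le
        _ ≤ K ^ p * t := by
          gcongr
          calc t ^ p ≤ t ^ (1 : ℝ) := Real.rpow_le_rpow_of_exponent_ge ht ht1 (by linarith)
            _ = t := Real.rpow_one t⟩
  simpa only [abs_of_pos (soliton_pos hp _)] using h

/-- The trial function sits on one edge and the others carry zero. It vanishes at the vertex, so the
sequence is admissible for every N, including N = 1. -/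
theorem exists_minimising_sequence (hp : 2 < p) (hN : 1 ≤ N) :
    ∃ w : ℕ → StarGraph N → ℝ, (∀ n, MemH10 (w n)) ∧
      Tendsto (fun n => energy (w n)) atTop (𝓝 (solitonEnergy p)) ∧
      Tendsto (fun n => power p (w n)) atTop (𝓝 (solitonEnergy p)) := by
  obtain ⟨K, hK, hbd⟩ := exists_trial_bound hp
  set e₀ : Fin N := ⟨0, hN⟩
  set F : ℕ → Fin N → ℝ → ℝ := fun n e x => if e = e₀ then trial p n x else 0 with hF
  set G : ℕ → Fin N → ℝ → ℝ := fun n e x => if e = e₀ then trialDeriv p n x else 0 with hG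
  have hF0 : ∀ n e, F n e 0 = 0 := fun n e => by simp [hF, trial_zero]
  set w : ℕ → StarGraph N → ℝ := fun n => glue (F n) (fun e e' => by rw [hF0, hF0]) with hw
  have hwF : ∀ n e (x : ℝ≥0), w n (pt e x) = F n e x := fun n e x => rfl
  have hd : ∀ n e x, HasDerivAt (F n e) (G n e x) x := by
    intro n e x
    by_cases he : e = e₀
    · simp only [hF, hG, he, if_true]
      exact hasDerivAt_trial hp n x
    · simp only [hF, hG, he, if_false]
      exact hasDerivAt_const x 0
  have hLF : ∀ n e, MemLp (F n e) 2 (volume.restrict (Ioi 0)) := by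
    intro n e
    by_cases he : e = e₀
    · simp only [hF, he, if_true]
      exact memLp_of_exp_bound (continuous_trial hp n)
        fun x hx => (hbd n x (Nat.cast_nonneg n) hx).1
    · simp only [hF, he, if_false]
      exact MemLp.zero
  have hLG : ∀ n e, MemLp (G n e) 2 (volume.restrict (Ioi 0)) := by
    intro n e
    by_cases he : e = e₀
    · simp only [hG, he, if_true]
      exact memLp_of_exp_bound (continuous_trialDeriv hp n)
        fun x hx => (hbd n x (Nat.cast_nonneg n) hx).2
    · simp only [hG, he, if_false]
      exact MemLp.zero
  refine ⟨w, fun n => ⟨continuous_of_continuous_edges (hwF n) fun e =>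
    continuous_iff_continuousAt.2 fun x => (hd n e x).continuousAt,
    fun e => memH1_onEdge (hwF n e) (hd n e) (hLF n e) (hLG n e), fun _ e => ?_⟩, ?_, ?_⟩
  · rw [hwF]
    exact hF0 n e
  · refine (tendsto_energy_trial hp).congr fun n => ?_
    rw [energy, Finset.sum_eq_single e₀]
    · rw [energyOn_onEdge (hwF n e₀) (hd n e₀) (hLF n e₀) (hLG n e₀)]
      simp [hF, hG]
    · intro e _ he
      rw [energyOn_onEdge (hwF n e) (hd n e) (hLF n e) (hLG n e)]
      simp [hF, hG, he]
    · simp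
  · refine (tendsto_power_trial hp).congr fun n => ?_
    rw [power, Finset.sum_eq_single e₀]
    · rw [powerOn_onEdge (hwF n e₀)]
      simp [hF]
    · intro e _ he
      rw [powerOn_onEdge (hwF n e)]
      simp [hF, he, Real.zero_rpow (by linarith : p ≠ 0)]
    · simp

/-! ### Best constants and minimisers -/

theorem solitonEnergy_eq (hp : 2 < p) :
    solitonEnergy p = sobolevInf p * solitonEnergy p ^ (2 / p) := by
  rw [sobolevInf, ← Real.rpow_add (solitonEnergy_pos hp), sub_add_cancel, Real.rpow_one]

theorem starConst_eq (hp : 2 < p) (hN : 1 ≤ N) : starConst p N = (sobolevInf p)⁻¹ := by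
  have hS := sobolevInf_pos hp
  have : {C : ℝ | ∀ v : StarGraph N → ℝ, MemH10 v → (power p v) ^ (2 / p) ≤ C * energy v}
      = Ici (sobolevInf p)⁻¹ := by
    ext C
    constructor
    · intro hC
      obtain ⟨w, hw, hE, hP⟩ := exists_minimising_sequence hp hN
      have hlim := le_of_tendsto_of_tendsto' (hP.rpow_const (p := 2 / p)
        (Or.inl (solitonEnergy_pos hp).ne')) (hE.const_mul C) fun n => hC _ (hw n)
      nth_rw 2 [solitonEnergy_eq hp] at hlim
      have hpos := Real.rpow_pos_of_pos (solitonEnergy_pos hp) (2 / p)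
      rw [← mul_assoc] at hlim
      have h1 : 1 ≤ C * sobolevInf p := le_of_mul_le_mul_right (by linarith) hpos
      rw [mem_Ici, inv_eq_one_div, div_le_iff₀ hS]
      exact h1
    · intro hC v hv
      have hC0 : 0 ≤ C := (inv_pos.2 hS).le.trans hC
      by_cases hz : v = 0
      · rw [hz, power_zero hp, Real.zero_rpow (by positivity)]
        exact mul_nonneg hC0 (energy_nonneg _)
      · have h1 := (hv.sobolevInf_mul_le hp hN hz).1
        calc power p v ^ (2 / p) ≤ (sobolevInf p)⁻¹ * energy v := by
              rw [← div_eq_inv_mul, le_div_iff₀ hS]; linarith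
          _ ≤ C * energy v := mul_le_mul_of_nonneg_right hC (energy_nonneg _)
  rw [starConst, this, csInf_Ici]

/-- A minimum would be at most the limit `sobolevInf p` along the sequence, against the strict
inequality. -/
theorem not_isMinimiser (hp : 2 < p) (hN : 1 ≤ N) (hN2 : N ≠ 2) (v : StarGraph N → ℝ) :
    ¬IsMinimiser p v := by
  rintro ⟨hv, hne, hmin⟩
  obtain ⟨w, hw, hE, hP⟩ := exists_minimising_sequence hp hN
  have hA := solitonEnergy_pos hp
  have hlim : Tendsto (fun n => functional p (w n)) atTop (𝓝 (sobolevInf p)) := by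
    have := hE.div (hP.rpow_const (p := 2 / p) (Or.inl hA.ne'))
      (Real.rpow_pos_of_pos hA _).ne'
    nth_rw 1 [solitonEnergy_eq hp] at this
    rwa [mul_div_cancel_right₀ _ (Real.rpow_pos_of_pos hA _).ne'] at this
  have hle : functional p v ≤ sobolevInf p := by
    refine ge_of_tendsto hlim ?_
    filter_upwards [hP.eventually (lt_mem_nhds hA)] with n hn
    refine hmin _ (hw n) fun hz => ?_
    rw [hz, power_zero hp] at hn
    exact lt_irrefl _ hn
  have h1 := (hv.sobolevInf_mul_le hp hN hne).2 hN2
  have h2 : sobolevInf p < functional p v := by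
    rwa [functional, lt_div_iff₀ (Real.rpow_pos_of_pos (power_pos hp hv hne) _)]
  exact absurd hle (not_le.2 h2)

/-! ### The line -/

theorem integral_eq_add_comp_neg {U : ℝ → ℝ} (hU : Integrable U) :
    ∫ x, U x = (∫ x in Ioi 0, U x) + ∫ x in Ioi 0, U (-x) := by
  rw [integral_comp_neg_Ioi, neg_zero, add_comm,
    ← setIntegral_union (Iic_disjoint_Ioi le_rfl) measurableSet_Ioi hU.integrableOn
      hU.integrableOn, Iic_union_Ioi, setIntegral_univ]

theorem MemLp.comp_neg {f : ℝ → ℝ} (hf : MemLp f 2) : MemLp (fun x => f (-x)) 2 :=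
  hf.comp_measurePreserving (Measure.measurePreserving_neg volume)

/-- Fold the line at 0: the continuous representative F and its reflection form a function on a star
with two edges, indexed by `Bool`. -/
theorem MemH1.sobolevInf_mul_le (hp : 2 < p) {f : ℝ → ℝ} (hf : MemH1 univ f) :
    sobolevInf p * powerOn p univ f ^ (2 / p) ≤ energyOn univ f := by
  set g := weakDeriv univ f with hg
  obtain ⟨C, hC⟩ := hf.weakDeriv_spec.exists_ae_eq_primitive isOpen_univ ordConnected_univ
    (mem_univ (0 : ℝ)) hf.1
  have hg2 := hf.weakDeriv_spec.1
  have hf2 := hf.1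
  rw [Measure.restrict_univ] at hC hg2 hf2
  rw [← hg] at hg2 hC
  set F : ℝ → ℝ := fun x => C + ∫ t in (0 : ℝ)..x, g t with hF
  have hF2 : MemLp F 2 := hf2.ae_eq hC
  have hgi : ∀ a b, IntervalIntegrable g volume a b := fun a b => by
    have := intervalIntegrable_indicator_of_memLp MeasurableSet.univ (g := g)
      (by rwa [Measure.restrict_univ]) a b
    rwa [indicator_univ] at this
  have hF0 : F 0 = C := by simp [hF]
  have hE : energyOn univ f = ∫ x, (g x ^ 2 + F x ^ 2) := by
    rw [energyOn, setIntegral_univ]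
    refine integral_congr_ae ?_
    filter_upwards [hC] with x hx
    rw [hx]
  have hP : powerOn p univ f = ∫ x, |F x| ^ p := by
    rw [powerOn, setIntegral_univ]
    refine integral_congr_ae ?_
    filter_upwards [hC] with x hx
    rw [hx]
  have h₁ : HalfLineH1 F g := ⟨hF2.restrict _, hg2.restrict _, fun x _ => by rw [hF0]⟩
  have h₂ : HalfLineH1 (fun x => F (-x)) (fun x => -g (-x)) := by
    refine ⟨(MemLp.comp_neg hF2).restrict _, (MemLp.comp_neg hg2).neg.restrict _, fun x _ => ?_⟩
    rw [intervalIntegral.integral_neg, intervalIntegral.integral_comp_neg, neg_zero, hF0,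
      ← intervalIntegral.integral_symm]
  have hPi : Integrable fun x => |F x| ^ p := by
    have i₁ := h₁.integrable_rpow hp
    have i₂ := (integrableOn_Ici_iff_integrableOn_Ioi).2 (h₂.integrable_rpow hp)
    have i₃ : IntegrableOn (fun x => |F x| ^ p) (Iic 0) := by
      have := (Measure.measurePreserving_neg (volume : Measure ℝ)).integrableOn_comp_preimage
        (Homeomorph.neg ℝ).measurableEmbedding (f := fun x => |F x| ^ p) (s := Iic 0)
      refine this.1 ?_
      simpa [Function.comp_def] using i₂
    rw [← integrableOn_univ, ← Iic_union_Ioi (a := (0 : ℝ))]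
    exact i₃.union i₁
  have hEi : Integrable fun x => g x ^ 2 + F x ^ 2 := hg2.integrable_sq.add hF2.integrable_sq
  rw [hE, hP]
  by_cases hz : ∀ x, F x = 0
  · have : ∫ x, |F x| ^ p = 0 := by simp [hz, Real.zero_rpow (by linarith : p ≠ 0)]
    rw [this, Real.zero_rpow (by positivity), mul_zero]
    exact integral_nonneg fun x => by positivity
  push Not at hz
  obtain ⟨y, hy⟩ := hz
  have key := (KirchhoffStar.sobolevInf_mul_le (ι := Bool) hp (a := C)
    (f := fun b => cond b F fun x => F (-x)) (g := fun b => cond b g fun x => -g (-x))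
    (fun b => by cases b; exacts [h₂, h₁]) (fun b => by cases b <;> simp [hF0])
    (fun h => by simp at h) (by
      rcases le_total 0 y with h | h
      · exact ⟨true, y, h, hy⟩
      · exact ⟨false, -y, by linarith, by simpa using hy⟩)).1
  simp only [Fintype.sum_bool, cond_true, cond_false, neg_sq] at key
  rwa [integral_eq_add_comp_neg hEi, integral_eq_add_comp_neg hPi]

theorem lineConst_eq (hp : 2 < p) : lineConst p = (sobolevInf p)⁻¹ := by
  have hS := sobolevInf_pos hp
  have hEn : ∀ f, 0 ≤ energyOn univ f := fun f => integral_nonneg fun x => by positivity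
  have : {C : ℝ | ∀ f : ℝ → ℝ, MemH1 univ f →
      (powerOn p univ f) ^ (2 / p) ≤ C * energyOn univ f} = Ici (sobolevInf p)⁻¹ := by
    ext C
    constructor
    · intro hC
      have hw : HasL2WeakDeriv univ (soliton p) (solitonDeriv p) :=
        hasL2WeakDeriv_of_hasDerivAt ((memLp_soliton hp).restrict _)
          ((memLp_solitonDeriv hp).restrict _) fun x _ => hasDerivAt_soliton hp x
      have hm : MemH1 univ (soliton p) := ⟨(memLp_soliton hp).restrict _, _, hw⟩
      have h1 := hC _ hm
      rw [energyOn_eq isOpen_univ hw, powerOn, setIntegral_univ, setIntegral_univ] at h1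
      simp only [abs_of_pos (soliton_pos hp _)] at h1
      rw [integral_soliton_rpow hp] at h1
      change _ ≤ C * solitonEnergy p at h1
      nth_rw 2 [solitonEnergy_eq hp] at h1
      have hpos := Real.rpow_pos_of_pos (solitonEnergy_pos hp) (2 / p)
      rw [← mul_assoc] at h1
      have h2 : 1 ≤ C * sobolevInf p := le_of_mul_le_mul_right (by linarith) hpos
      rw [mem_Ici, inv_eq_one_div, div_le_iff₀ hS]
      exact h2
    · intro hC f hf
      calc powerOn p univ f ^ (2 / p) ≤ (sobolevInf p)⁻¹ * energyOn univ f := by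
            rw [← div_eq_inv_mul, le_div_iff₀ hS]
            linarith [hf.sobolevInf_mul_le hp]
        _ ≤ C * energyOn univ f := mul_le_mul_of_nonneg_right hC (hEn f)
  rw [lineConst, this, csInf_Ici]

/-! ### Translated solitons on the edges -/

section Shifted

variable {v : StarGraph N → ℝ} {τ : Fin N → ℝ}

theorem hasDerivAt_shift (hp : 2 < p) (t x : ℝ) :
    HasDerivAt (fun x => soliton p (x + t)) (solitonDeriv p (x + t)) x :=
  (hasDerivAt_soliton hp (x + t)).comp_add_const x t

theorem memLp_shift {f : ℝ → ℝ} (hf : MemLp f 2) (t : ℝ) : MemLp (fun x => f (x + t)) 2 :=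
  hf.comp_measurePreserving (measurePreserving_add_right volume t)

theorem continuous_of_shifted (hp : 2 < p)
    (h : ∀ e (x : ℝ≥0), v (pt e x) = soliton p (x + τ e)) : Continuous v :=
  continuous_of_continuous_edges (F := fun e x => soliton p (x + τ e)) h fun e =>
    continuous_iff_continuousAt.2 fun x => (hasDerivAt_shift hp (τ e) x).continuousAt

theorem memH10_of_shifted (hp : 2 < p) (hN : N ≠ 1)
    (h : ∀ e (x : ℝ≥0), v (pt e x) = soliton p (x + τ e)) : MemH10 v :=
  ⟨continuous_of_shifted hp h, fun e => memH1_onEdge (F := fun x => soliton p (x + τ e)) (h e)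
    (hasDerivAt_shift hp (τ e)) ((memLp_shift (memLp_soliton hp) _).restrict _)
    ((memLp_shift (memLp_solitonDeriv hp) _).restrict _), fun h1 => absurd h1 hN⟩

theorem hasDerivWithinAt_of_shifted (hp : 2 < p) {e : Fin N}
    (h : ∀ x : ℝ≥0, v (pt e x) = soliton p (x + τ e)) :
    HasDerivWithinAt (onEdge v e) (solitonDeriv p (τ e)) (Ici 0) 0 := by
  have := (hasDerivAt_shift hp (τ e) 0).hasDerivWithinAt (s := Ici 0)
  rw [zero_add] at this
  exact this.congr (fun x hx => onEdge_eq (F := fun x => soliton p (x + τ e)) h hx)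
    (onEdge_eq (F := fun x => soliton p (x + τ e)) h le_rfl)

theorem isSolution_of_shifted (hp : 2 < p) (hN : N ≠ 1)
    (h : ∀ e (x : ℝ≥0), v (pt e x) = soliton p (x + τ e))
    (hsum : ∑ e, solitonDeriv p (τ e) = 0) : IsSolution p v := by
  refine ⟨memH10_of_shifted hp hN h, fun e => ⟨?_, fun x hx => ?_⟩, fun _ =>
    ⟨fun e => solitonDeriv p (τ e), fun e => hasDerivWithinAt_of_shifted hp (h e), hsum⟩⟩
  · have hc : ContDiff ℝ 2 fun x => soliton p (x + τ e) :=
      (contDiff_soliton p).comp (contDiff_id.add contDiff_const)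
    exact hc.contDiffOn.congr fun x hx =>
      onEdge_eq (F := fun x => soliton p (x + τ e)) (h e) (le_of_lt hx)
  · have hev : ∀ y : ℝ, 0 < y → onEdge v e =ᶠ[𝓝 y] fun x => soliton p (x + τ e) := fun y hy => by
      filter_upwards [Ioi_mem_nhds hy] with z hz
      exact onEdge_eq (F := fun x => soliton p (x + τ e)) (h e) (le_of_lt hz)
    have hd : deriv (onEdge v e) =ᶠ[𝓝 x] fun x => solitonDeriv p (x + τ e) := by
      filter_upwards [Ioi_mem_nhds hx] with z hz
      rw [(hev z hz).deriv_eq, (hasDerivAt_shift hp (τ e) z).deriv]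
    have hd2 := ((hasDerivAt_solitonDeriv hp (x + τ e)).comp_add_const x (τ e)).deriv
    rw [hd.deriv_eq, hd2, (hev x hx).eq_of_nhds, abs_of_pos (soliton_pos hp _)]
    ring

end Shifted

theorem shift_unique (hp : 2 < p) {t t' : ℝ}
    (h : ∀ x : ℝ≥0, soliton p (x + t) = soliton p (x + t')) : t = t' := by
  -- At this point both arguments are nonnegative, so the evenness of the soliton causes no
  -- ambiguity.
  have h1 := abs_eq_of_soliton_eq hp (h ⟨|t| + |t'|, by positivity⟩)
  have h2 := neg_abs_le t
  have h3 := neg_abs_le t'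
  have h4 := abs_nonneg t
  have h5 := abs_nonneg t'
  change |(|t| + |t'|) + t| = |(|t| + |t'|) + t'| at h1
  rw [abs_of_nonneg (show 0 ≤ |t| + |t'| + t by linarith),
    abs_of_nonneg (show 0 ≤ |t| + |t'| + t' by linarith)] at h1
  linarith

/-- Shifts are unique, so the choice of direction made at e is compatible with the one at σ e.
Quantities odd or complementary under t ↦ -t can then be summed by pairs. -/
theorem IsPairedSoliton.exists_shifts (hp : 2 < p) {v : StarGraph N → ℝ}
    (h : IsPairedSoliton p v) :
    ∃ (σ : Equiv.Perm (Fin N)) (τ : Fin N → ℝ), (∀ e, σ e ≠ e) ∧ (∀ e, τ (σ e) = -τ e) ∧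
      ∀ e (x : ℝ≥0), v (pt e x) = soliton p (x + τ e) := by
  obtain ⟨s, σ, hσ, hne, h⟩ := h
  have hex : ∀ e, ∃ t, ∀ x : ℝ≥0, v (pt e x) = soliton p (x + t) := by
    intro e
    rcases h e with h | h
    · exact ⟨s, h.1⟩
    · exact ⟨-s, fun x => by rw [h.1, sub_eq_add_neg]⟩
  choose τ hτ using hex
  have hu : ∀ e t, (∀ x : ℝ≥0, v (pt e x) = soliton p (x + t)) → τ e = t := fun e t ht =>
    shift_unique hp fun x => by rw [← hτ, ht]
  refine ⟨hσ.toPerm, τ, hne, fun e => ?_, hτ⟩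
  change τ (σ e) = -τ e
  rcases h e with h | h
  · rw [hu e s h.1, hu (σ e) (-s) fun x => by rw [h.2, sub_eq_add_neg]]
  · rw [hu e (-s) fun x => by rw [h.1, sub_eq_add_neg], hu (σ e) s h.2, neg_neg]

/-- Summing over pairs counts every edge twice. It serves for the derivatives (c = 0), the energy
and the power. -/
theorem sum_eq_of_perm_add {σ : Equiv.Perm (Fin N)} {a : Fin N → ℝ} {c : ℝ}
    (h : ∀ e, a e + a (σ e) = c) : 2 * ∑ e, a e = N * c := by
  have h1 : ∑ e, a (σ e) = ∑ e, a e := Equiv.sum_comp σ a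
  have h2 : ∑ e, (a e + a (σ e)) = N * c := by simp [h]
  rw [Finset.sum_add_distrib, h1] at h2
  linarith

theorem ne_one_of_perm_ne {σ : Equiv.Perm (Fin N)} (h : ∀ e, σ e ≠ e) : N ≠ 1 := by
  rintro rfl
  exact h 0 (Subsingleton.elim _ _)

theorem IsPairedSoliton.isSolution (hp : 2 < p) {v : StarGraph N → ℝ}
    (h : IsPairedSoliton p v) : IsSolution p v := by
  obtain ⟨σ, τ, hne, hτ, hv⟩ := h.exists_shifts hp
  refine isSolution_of_shifted hp (ne_one_of_perm_ne hne) hv ?_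
  have := sum_eq_of_perm_add (σ := σ) (a := fun e => solitonDeriv p (τ e)) (c := 0) fun e => by
    rw [hτ, solitonDeriv_neg, add_neg_cancel]
  linarith

theorem IsPairedSoliton.pos (hp : 2 < p) {v : StarGraph N → ℝ} (h : IsPairedSoliton p v)
    (y : StarGraph N) : 0 < v y := by
  obtain ⟨σ, τ, -, -, hv⟩ := h.exists_shifts hp
  obtain ⟨e, x, rfl⟩ := exists_eq_pt y
  rw [hv]
  exact soliton_pos hp _

theorem integral_shift_add {F : ℝ → ℝ} (hF : Integrable F) (heven : ∀ x, F (-x) = F x) (t : ℝ) :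
    (∫ x in Ioi 0, F (x + t)) + ∫ x in Ioi 0, F (x + -t) = ∫ x, F x := by
  have h1 := integral_eq_add_comp_neg (hF.comp_add_right t)
  rw [integral_add_right_eq_self F t] at h1
  rw [h1]
  congr 2
  ext x
  rw [← heven]
  congr 1
  ring

/-- The two half-lines together carry one whole soliton, so energy and power both equal
`solitonEnergy p`, the equality case. -/
theorem IsPairedSoliton.isMinimiser (hp : 2 < p) {v : StarGraph 2 → ℝ}
    (h : IsPairedSoliton p v) : IsMinimiser p v := by
  obtain ⟨σ, τ, hne, hτ, hv⟩ := h.exists_shifts hp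
  have hm := memH10_of_shifted hp (by norm_num) hv
  have hA := solitonEnergy_pos hp
  have hE : energy v = solitonEnergy p := by
    have := sum_eq_of_perm_add (σ := σ) (a := fun e => energyOn (Ioi 0) (onEdge v e))
      (c := solitonEnergy p) fun e => by
        have he := fun e => energyOn_onEdge (F := fun x => soliton p (x + τ e)) (hv e)
          (hasDerivAt_shift hp (τ e)) ((memLp_shift (memLp_soliton hp) _).restrict _)
          ((memLp_shift (memLp_solitonDeriv hp) _).restrict _)
        simp only [he, hτ]
        exact integral_shift_add (F := fun x => solitonDeriv p x ^ 2 + soliton p x ^ 2)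
          (integrable_solitonEnergy hp)
          (fun x => by rw [soliton_neg, solitonDeriv_neg, neg_sq]) (τ e)
    unfold energy
    push_cast at this
    linarith
  have hP : power p v = solitonEnergy p := by
    have := sum_eq_of_perm_add (σ := σ) (a := fun e => powerOn p (Ioi 0) (onEdge v e))
      (c := solitonEnergy p) fun e => by
        have he := fun e => powerOn_onEdge (p := p) (F := fun x => soliton p (x + τ e)) (hv e)
        simp only [he, hτ, abs_of_pos (soliton_pos hp _)]
        rw [integral_shift_add (F := fun x => soliton p x ^ p) (integrable_soliton_rpow hp)
          (fun x => by rw [soliton_neg]) (τ e), integral_soliton_rpow hp]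
    unfold power
    push_cast at this
    linarith
  refine ⟨hm, fun hz => ?_, fun w hw hwne => ?_⟩
  · have := h.pos hp (pt 0 0)
    rw [hz] at this
    exact lt_irrefl _ this
  · rw [functional, functional, hE, hP]
    nth_rw 1 [solitonEnergy_eq hp]
    rw [mul_div_cancel_right₀ _ (Real.rpow_pos_of_pos hA _).ne',
      le_div_iff₀ (Real.rpow_pos_of_pos (power_pos hp hw hwne) _)]
    exact (hw.sobolevInf_mul_le hp (by norm_num) hwne).1

/-- Join a bijection from P to its complement with its inverse. -/
theorem exists_involutive_of_card_eq {P : Finset (Fin N)} (h : P.card = Pᶜ.card) :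
    ∃ σ : Fin N → Fin N, Function.Involutive σ ∧ ∀ e, σ e ∈ P ↔ e ∉ P := by
  have E : P ≃ (Pᶜ : Finset (Fin N)) := Finset.equivOfCardEq h
  have hc : ∀ {e}, e ∉ P → e ∈ Pᶜ := fun he => Finset.mem_compl.2 he
  refine ⟨fun e => if he : e ∈ P then (E ⟨e, he⟩ : Fin N) else E.symm ⟨e, hc he⟩, fun e => ?_,
    fun e => ?_⟩
  · by_cases he : e ∈ P
    · have h1 : (E ⟨e, he⟩ : Fin N) ∉ P := Finset.mem_compl.1 (E ⟨e, he⟩).2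
      simp [he, h1]
    · have h1 : (E.symm ⟨e, hc he⟩ : Fin N) ∈ P := (E.symm ⟨e, hc he⟩).2
      simp [he]
  · by_cases he : e ∈ P
    · have h1 : (E ⟨e, he⟩ : Fin N) ∉ P := Finset.mem_compl.1 (E ⟨e, he⟩).2
      simp [he, h1]
    · simp [he]

theorem exists_card_eq_compl (hN : Even N) : ∃ P : Finset (Fin N), P.card = Pᶜ.card := by
  obtain ⟨k, hk⟩ := hN
  obtain ⟨P, -, hP⟩ := Finset.exists_subset_card_eq (s := (Finset.univ : Finset (Fin N)))
    (n := k) (by simp; omega)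
  refine ⟨P, ?_⟩
  rw [Finset.card_compl, Fintype.card_fin]
  omega

theorem isPairedSoliton_of_card {v : StarGraph N → ℝ} {P : Finset (Fin N)}
    (hP : P.card = Pᶜ.card) {s : ℝ}
    (h₁ : ∀ e ∈ P, ∀ x : ℝ≥0, v (pt e x) = soliton p (x + s))
    (h₂ : ∀ e ∉ P, ∀ x : ℝ≥0, v (pt e x) = soliton p (x - s)) : IsPairedSoliton p v := by
  obtain ⟨σ, hσ, hσP⟩ := exists_involutive_of_card_eq hP
  refine ⟨s, σ, hσ, fun e he => ?_, fun e => ?_⟩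
  · have := hσP e
    rw [he] at this
    tauto
  · by_cases he : e ∈ P
    · exact Or.inl ⟨h₁ e he, h₂ _ fun h => (hσP e).1 h he⟩
    · exact Or.inr ⟨h₂ e he, h₁ _ ((hσP e).2 he)⟩

theorem exists_isPairedSoliton (p : ℝ) (hN : Even N) (s : ℝ) :
    ∃ v : StarGraph N → ℝ, IsPairedSoliton p v ∧ ∀ e, v (pt e 0) = soliton p s := by
  obtain ⟨P, hP⟩ := exists_card_eq_compl hN
  set F : Fin N → ℝ → ℝ := fun e x => if e ∈ P then soliton p (x + s) else soliton p (x - s)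
  have hF : ∀ e, F e 0 = soliton p s := by
    intro e
    simp only [F, zero_add, zero_sub, soliton_neg, ite_self]
  refine ⟨glue F fun e e' => by rw [hF, hF], isPairedSoliton_of_card hP (s := s) (fun e he x => ?_)
    fun e he x => ?_, fun e => ?_⟩
  · simp [glue_pt, F, he]
  · simp [glue_pt, F, he]
  · rw [glue_pt]
    exact hF e

theorem infinite_positive_solutions (hp : 2 < p) (hN1 : 1 ≤ N) (hN : Even N) :
    {v : StarGraph N → ℝ | IsSolution p v ∧ ∀ x, 0 < v x}.Infinite := by
  choose V hV hV0 using fun n : ℕ => exists_isPairedSoliton p hN (n : ℝ)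
  -- The shifts s = 0, 1, 2, … are told apart by the value at the vertex.
  refine infinite_of_injective_forall_mem (f := V) (fun m n hmn => ?_) fun n =>
    ⟨(hV n).isSolution hp, (hV n).pos hp⟩
  have h := abs_eq_of_soliton_eq hp (s := m) (t := n) (by
    rw [← hV0 m ⟨0, hN1⟩, ← hV0 n ⟨0, hN1⟩, hmn])
  rw [Nat.abs_cast, Nat.abs_cast] at h
  exact_mod_cast h

/-! ### Classification of the solutions -/

theorem eqOn_const_of_hasDerivAt_zero {f : ℝ → ℝ} (h : ∀ x, 0 < x → HasDerivAt f 0 x) :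
    ∃ a, ∀ x, 0 < x → f x = a :=
  isOpen_Ioi.exists_is_const_of_deriv_eq_zero isPreconnected_Ioi
    (fun x hx => (h x hx).differentiableAt.differentiableWithinAt) fun x hx => (h x hx).deriv

/-- A positive function on the half-line with the energy identity of the soliton is a
translated soliton. -/
theorem exists_eq_soliton (hp : 2 < p) {u u₁ : ℝ → ℝ} (hc : ContinuousOn u (Ici 0))
    (hpos : ∀ x, 0 ≤ x → 0 < u x) (h1 : ∀ x, 0 < x → HasDerivAt u (u₁ x) x)
    (h2 : ∀ x, 0 < x → HasDerivAt u₁ (u x - u x ^ (p - 2) * u x) x)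
    (hE : ∀ x, 0 < x → u₁ x ^ 2 = u x ^ 2 - 2 / p * u x ^ p) :
    ∃ t, ∀ x, 0 ≤ x → u x = soliton p (x + t) := by
  set q := (p - 2) / 2 with hq
  have hq0 : 0 < q := by rw [hq]; linarith
  have hp0 : 0 < p := by linarith
  -- This power turns the soliton into a multiple of cosh; the zero-energy identity makes the
  -- equation for w linear, w'' = q²w.
  set w : ℝ → ℝ := fun x => u x ^ (-q) with hw
  set w₁ : ℝ → ℝ := fun x => -q * w x * (u₁ x / u x) with hw₁
  have hwpos : ∀ x, 0 ≤ x → 0 < w x := fun x hx => Real.rpow_pos_of_pos (hpos x hx) _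
  have hw2 : ∀ x, 0 ≤ x → w x ^ 2 * u x ^ (p - 2) = 1 := by
    intro x hx
    have h0 := hpos x hx
    simp only [hw]
    rw [← Real.rpow_natCast, ← Real.rpow_mul h0.le, ← Real.rpow_add h0]
    rw [show -q * ((2 : ℕ) : ℝ) + (p - 2) = 0 by push_cast; rw [hq]; ring, Real.rpow_zero]
  have hdw : ∀ x, 0 < x → HasDerivAt w (w₁ x) x := by
    intro x hx
    have h0 := hpos x hx.le
    refine ((h1 x hx).rpow_const (p := -q) (Or.inl h0.ne')).congr_deriv ?_
    simp only [hw₁, hw]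
    rw [Real.rpow_sub_one h0.ne']
    field_simp
  have hsq : ∀ x, 0 < x → (u₁ x / u x) ^ 2 = 1 - 2 / p * u x ^ (p - 2) := by
    intro x hx
    have h0 := hpos x hx.le
    rw [div_pow, hE x hx, rpow_eq_sq_mul hp h0.le]
    field_simp
  have hdw₁ : ∀ x, 0 < x → HasDerivAt w₁ (q ^ 2 * w x) x := by
    intro x hx
    have h0 := hpos x hx.le
    have hd := ((hdw x hx).const_mul (-q)).mul ((h2 x hx).div (h1 x hx) h0.ne')
    refine hd.congr_deriv ?_
    have hs := hsq x hx
    have e1 : ((u x - u x ^ (p - 2) * u x) * u x - u₁ x * u₁ x) / u x ^ 2 =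
        1 - u x ^ (p - 2) - (u₁ x / u x) ^ 2 := by
      field_simp
    simp only [Pi.div_apply]
    rw [e1]
    simp only [hw₁]
    rw [show -q * (-q * w x * (u₁ x / u x)) * (u₁ x / u x) = q ^ 2 * w x * (u₁ x / u x) ^ 2 by
      ring, hs, hq]
    field_simp
    ring
  have hinv : ∀ x, 0 < x → w x ^ 2 - (w₁ x / q) ^ 2 = 2 / p := by
    intro x hx
    have e1 : (w₁ x / q) ^ 2 = w x ^ 2 * (u₁ x / u x) ^ 2 := by
      simp only [hw₁]
      field_simp
    rw [e1, hsq x hx]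
    linear_combination 2 / p * hw2 x hx.le
  -- A and B are the coefficients of exp(qx) and exp(-qx) in w. The invariant `hinv` fixes 4AB =
  -- 2/p, and w > 0 makes them positive.
  obtain ⟨A, hA⟩ := eqOn_const_of_hasDerivAt_zero
    (f := fun x => Real.exp (-(q * x)) * (w x + w₁ x / q) / 2) (fun x hx => by
      have h3 := ((((hasDerivAt_id x).const_mul q).neg.exp).mul
        ((hdw x hx).add ((hdw₁ x hx).div_const q))).div_const 2
      refine h3.congr_deriv ?_
      simp only [id, Pi.add_apply]
      field_simp
      ring)
  obtain ⟨B, hB⟩ := eqOn_const_of_hasDerivAt_zero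
    (f := fun x => Real.exp (q * x) * (w x - w₁ x / q) / 2) (fun x hx => by
      have h3 := ((((hasDerivAt_id x).const_mul q).exp).mul
        ((hdw x hx).sub ((hdw₁ x hx).div_const q))).div_const 2
      refine h3.congr_deriv ?_
      simp only [id, Pi.sub_apply]
      field_simp
      ring)
  have hwAB : ∀ x, 0 < x → w x = A * Real.exp (q * x) + B * Real.exp (-(q * x)) := by
    intro x hx
    rw [← hA x hx, ← hB x hx, Real.exp_neg]
    field_simp
    ring
  have hAB : A * B = 1 / (2 * p) := by
    have h3 := hinv 1 one_pos
    have h4 : Real.exp (-(q * 1)) * Real.exp (q * 1) = 1 := by rw [← Real.exp_add]; simp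
    rw [← hA 1 one_pos, ← hB 1 one_pos]
    calc _ = (Real.exp (-(q * 1)) * Real.exp (q * 1)) * (w 1 ^ 2 - (w₁ 1 / q) ^ 2) / 4 := by ring
      _ = _ := by rw [h4, h3]; field_simp; norm_num
  have hA0 : 0 < A := by
    have hABp : 0 < A * B := by rw [hAB]; positivity
    rcases mul_pos_iff.1 hABp with h | h
    · exact h.1
    · have h3 := hwpos 1 zero_le_one
      rw [hwAB 1 one_pos] at h3
      have := mul_neg_of_neg_of_pos h.1 (Real.exp_pos (q * 1))
      have := mul_neg_of_neg_of_pos h.2 (Real.exp_pos (-(q * 1)))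
      linarith
  set r := √(2 / p) with hr
  have hr0 : 0 < r := Real.sqrt_pos.2 (by positivity)
  have hr2 : r ^ 2 = 2 / p := Real.sq_sqrt (by positivity)
  -- Chosen so that A = r·exp(qt)/2; then B = r·exp(-qt)/2 because 4AB = r².
  set t := Real.log (2 * A / r) / q with ht
  have het : Real.exp (q * t) = 2 * A / r := by
    rw [ht, mul_div_cancel₀ _ hq0.ne', Real.exp_log (by positivity)]
  have hwc : ∀ x, 0 < x → w x = r * Real.cosh (q * (x + t)) := by
    intro x hx
    rw [hwAB x hx, Real.cosh_eq, mul_add, neg_add, Real.exp_add, Real.exp_add, het,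
      Real.exp_neg (q * t), het]
    have hB' : B = r ^ 2 / (4 * A) := by
      rw [hr2]
      field_simp
      have : A * B * (2 * p) = 1 := by rw [hAB]; field_simp
      linarith
    rw [hB']
    field_simp
    ring
  refine ⟨t, ?_⟩
  have hsol : EqOn u (fun x => soliton p (x + t)) (Ioi 0) := by
    intro x hx
    have h0 := hpos x (le_of_lt hx)
    have e1 : u x = w x ^ (-(1 / q)) := by
      simp only [hw]
      rw [← Real.rpow_mul h0.le, show -q * -(1 / q) = 1 by field_simp, Real.rpow_one]
    change u x = soliton p (x + t)
    rw [e1, hwc x hx, Real.mul_rpow hr0.le (Real.cosh_pos _).le, soliton]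
    congr 1
    · rw [hr, Real.sqrt_eq_rpow, ← Real.rpow_mul (by positivity), ← inv_div p 2,
        Real.inv_rpow (by positivity), ← Real.rpow_neg (by positivity)]
      congr 1
      rw [hq]
      have : p - 2 ≠ 0 := by linarith
      field_simp
    · congr 1
      · congr 1
        rw [hq]; ring
      · rw [hq]
        have : p - 2 ≠ 0 := by linarith
        field_simp
  have hcs : ContinuousOn (fun x => soliton p (x + t)) (Ici 0) :=
    ((continuous_soliton hp).comp (continuous_add_const t)).continuousOn
  exact fun x hx => hsol.of_subset_closure hc hcs Ioi_subset_Ici_self (by rw [closure_Ioi]) hx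

/-- Lebesgue differentiation; it transfers the integrability of the weak derivative to the classical
one in the differential equation. -/
theorem HalfLineH1.ae_eq_deriv {f g : ℝ → ℝ} (h : HalfLineH1 f g) :
    ∀ᵐ x ∂(volume.restrict (Ioi 0)), g x = deriv f x := by
  have hl : LocallyIntegrable ((Ioi 0).indicator g) :=
    ((memLp_indicator_iff_restrict measurableSet_Ioi).2 h.memLp_deriv).locallyIntegrable
      (by norm_num)
  filter_upwards [ae_restrict_of_ae (LocallyIntegrable.ae_hasDerivAt_integral hl),
    ae_restrict_mem measurableSet_Ioi]
    with x hx hx0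
  have h1 := (hx 0).const_add (f 0)
  rw [indicator_of_mem hx0] at h1
  refine ((h1.congr_of_eventuallyEq ?_).deriv).symm
  filter_upwards [Ioi_mem_nhds hx0] with y hy
  rw [h.eq_primitive y (le_of_lt hy)]
  congr 1
  refine intervalIntegral.integral_congr_ae (ae_of_all _ fun t ht => ?_)
  exact (indicator_of_mem (lt_of_le_of_lt (le_min le_rfl (le_of_lt hy)) ht.1 : (0 : ℝ) < t) g).symm

section Edge

variable {v : StarGraph N → ℝ}

theorem IsSolution.hasDerivAt (hv : IsSolution p v) (e : Fin N) {x : ℝ} (hx : 0 < x) :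
    HasDerivAt (onEdge v e) (deriv (onEdge v e) x) x ∧
    HasDerivAt (deriv (onEdge v e))
      (onEdge v e x - |onEdge v e x| ^ (p - 2) * onEdge v e x) x := by
  obtain ⟨hc, hode⟩ := hv.2.1 e
  have h1 : DifferentiableOn ℝ (onEdge v e) (Ioi 0) := hc.differentiableOn (by norm_num)
  have h2 : ContDiffOn ℝ 1 (deriv (onEdge v e)) (Ioi 0) :=
    hc.deriv_of_isOpen isOpen_Ioi (by norm_num)
  refine ⟨(h1.differentiableAt (Ioi_mem_nhds hx)).hasDerivAt, ?_⟩
  have h3 := ((h2.differentiableOn (by norm_num)).differentiableAt (Ioi_mem_nhds hx)).hasDerivAt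
  refine h3.congr_deriv ?_
  linarith [hode x hx]

/-- Conservation of energy along an edge, where the decay at infinity forces the energy to be
zero. -/
theorem IsSolution.deriv_sq (hp : 2 < p) (hv : IsSolution p v) (e : Fin N) {x : ℝ} (hx : 0 < x) :
    deriv (onEdge v e) x ^ 2 = onEdge v e x ^ 2 - 2 / p * |onEdge v e x| ^ p := by
  have hH := hv.1.halfLineH1 e
  set u := onEdge v e
  obtain ⟨a, ha⟩ := eqOn_const_of_hasDerivAt_zero
    (f := fun x => deriv u x ^ 2 - (u x ^ 2 - 2 / p * |u x| ^ p)) (fun x hx => by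
      obtain ⟨h1, h2⟩ := hv.hasDerivAt e hx
      have h3 := (h2.pow 2).sub ((h1.pow 2).sub
        (((hasDerivAt_abs_rpow (u x) (by linarith : 1 < p)).comp x h1).const_mul (2 / p)))
      refine h3.congr_deriv ?_
      have hp0 : p ≠ 0 := by linarith
      change 2 * deriv u x ^ 1 * (u x - |u x| ^ (p - 2) * u x) -
        (2 * u x ^ 1 * deriv u x - 2 / p * (p * |u x| ^ (p - 2) * u x * deriv u x)) = 0
      field_simp
      ring)
  -- Each term of the conserved quantity is integrable, and a constant integrable on a set of
  -- infinite measure is zero.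
  have hint : Integrable (fun _ : ℝ => a) (volume.restrict (Ioi 0)) := by
    refine (hH.memLp_deriv.integrable_sq.sub (hH.memLp.integrable_sq.sub
      ((hH.integrable_rpow hp).const_mul (2 / p)))).congr ?_
    filter_upwards [hH.ae_eq_deriv, ae_restrict_mem measurableSet_Ioi] with x hx hx0
    rw [← ha x hx0]
    simp only [Pi.sub_apply, hx]
  have ha0 : a = 0 := by
    rw [integrable_const_iff] at hint
    rcases hint with h | h
    · exact h
    · have := h.measure_univ_lt_top
      rw [Measure.restrict_apply_univ, Real.volume_Ioi] at this
      exact absurd this (lt_irrefl _)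
  have := ha x hx
  rw [ha0] at this
  linarith

theorem IsSolution.abs_deriv_le (hp : 2 < p) (hv : IsSolution p v) (e : Fin N) {x : ℝ}
    (hx : 0 < x) : |deriv (onEdge v e) x| ≤ |onEdge v e x| := by
  refine sq_le_sq.1 ?_
  rw [hv.deriv_sq hp e hx]
  have : 0 ≤ 2 / p * |onEdge v e x| ^ p := by positivity
  linarith

/-- Zero energy gives |v'| ≤ |v|, so Grönwall applies from the vertex. No sign is needed, which
settles N = 1. -/
theorem IsSolution.eq_zero (hp : 2 < p) (hv : IsSolution p v) (h0 : ∀ e, v (pt e 0) = 0) :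
    v = 0 := by
  refine ext_onEdge fun e x hx => ?_
  have hH := hv.1.halfLineH1 e
  refine hH.eq_zero_of_abs_deriv_le (by rw [onEdge_zero, h0]) ?_ hx
  filter_upwards [hH.ae_eq_deriv, ae_restrict_mem measurableSet_Ioi] with x hx hx0
  rw [hx]
  exact hv.abs_deriv_le hp e hx0

/-- From u' ≥ -u, the function exp(x)u(x) is nondecreasing. -/
theorem IsSolution.onEdge_pos (hp : 2 < p) (hv : IsSolution p v) (hnn : ∀ y, 0 ≤ v y)
    {e : Fin N} (h0 : 0 < v (pt e 0)) {x : ℝ} (hx : 0 ≤ x) : 0 < onEdge v e x := by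
  have hc := continuous_onEdge hv.1.1 e
  have hmono : MonotoneOn (fun x => Real.exp x * onEdge v e x) (Ici 0) := by
    have hd : ∀ x, 0 < x → HasDerivAt (fun x => Real.exp x * onEdge v e x)
        (Real.exp x * onEdge v e x + Real.exp x * deriv (onEdge v e) x) x := fun x hx =>
      (Real.hasDerivAt_exp x).mul (hv.hasDerivAt e hx).1
    refine monotoneOn_of_deriv_nonneg (convex_Ici 0) (Real.continuous_exp.mul hc).continuousOn
      ?_ ?_ <;> rw [interior_Ici]
    · exact fun x hx => (hd x hx).differentiableAt.differentiableWithinAt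
    · intro x hx
      rw [(hd x hx).deriv, ← mul_add]
      have h1 := hv.abs_deriv_le hp e hx
      have h2 : 0 ≤ onEdge v e x := hnn _
      rw [abs_of_nonneg h2] at h1
      exact mul_nonneg (Real.exp_pos x).le (by linarith [(abs_le.1 h1).1])
  have h1 := hmono self_mem_Ici hx hx
  simp only [Real.exp_zero, one_mul] at h1
  rw [onEdge_zero] at h1
  exact pos_of_mul_pos_right (h0.trans_le h1) (Real.exp_pos x).le

theorem IsSolution.exists_shifts (hp : 2 < p) (hv : IsSolution p v)
    (hnn : ∀ y, 0 ≤ v y) (hne : v ≠ 0) :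
    ∃ τ : Fin N → ℝ, ∀ e (x : ℝ≥0), v (pt e x) = soliton p (x + τ e) := by
  have h0 : ∀ e, 0 < v (pt e 0) := by
    intro e
    refine lt_of_le_of_ne (hnn _) fun h => hne (hv.eq_zero hp fun e' => ?_)
    rw [pt_zero e' e, ← h]
  have : ∀ e, ∃ t, ∀ x, 0 ≤ x → onEdge v e x = soliton p (x + t) := by
    intro e
    have hpos := fun x (hx : (0 : ℝ) ≤ x) => hv.onEdge_pos hp hnn (h0 e) hx
    refine exists_eq_soliton hp (u₁ := deriv (onEdge v e))
      (continuous_onEdge hv.1.1 e).continuousOn hpos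
      (fun x hx => (hv.hasDerivAt e hx).1) (fun x hx => ?_) fun x hx => ?_
    · have := (hv.hasDerivAt e hx).2
      rwa [abs_of_pos (hpos x hx.le)] at this
    · have := hv.deriv_sq hp e hx
      rwa [abs_of_pos (hpos x hx.le)] at this
  choose τ hτ using this
  exact ⟨τ, fun e x => by rw [← onEdge_coe v, hτ e x x.2]⟩

/-- A nonzero nonnegative solution consists of solitons translated by a common distance; unless
this distance is zero, half of them are translated in each direction. -/
theorem IsSolution.exists_shift_and_set (hp : 2 < p) (hN : 1 ≤ N) (hN1 : N ≠ 1)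
    (hv : IsSolution p v) (hnn : ∀ y, 0 ≤ v y) (hne : v ≠ 0) :
    ∃ (s : ℝ) (P : Finset (Fin N)), (s = 0 ∨ P.card = Pᶜ.card) ∧
      (∀ e ∈ P, ∀ x : ℝ≥0, v (pt e x) = soliton p (x + s)) ∧
      (∀ e ∉ P, ∀ x : ℝ≥0, v (pt e x) = soliton p (x - s)) := by
  obtain ⟨τ, hτ⟩ := hv.exists_shifts hp hnn hne
  set s := τ ⟨0, hN⟩ with hs
  have habs : ∀ e, τ e = s ∨ τ e = -s := by
    intro e
    refine abs_eq_abs.1 (abs_eq_of_soliton_eq hp ?_)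
    have h1 := hτ e 0
    have h2 := hτ ⟨0, hN⟩ 0
    rw [NNReal.coe_zero, zero_add] at h1 h2
    rw [← h1, ← h2, pt_zero]
  refine ⟨s, Finset.univ.filter fun e => τ e = s, ?_, fun e he => ?_, fun e he => ?_⟩
  · by_cases hs0 : s = 0
    · exact Or.inl hs0
    refine Or.inr ?_
    obtain ⟨d, hd, hsum⟩ := hv.2.2 hN1
    -- All outward derivatives are ± the same nonzero number, so the Kirchhoff condition merely
    -- counts signs.
    have hde : ∀ e, d e = if τ e = s then solitonDeriv p s else -solitonDeriv p s := by
      intro e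
      have h1 := (uniqueDiffOn_Ici (0 : ℝ) 0 self_mem_Ici).eq_deriv _ (hd e)
        (hasDerivWithinAt_of_shifted hp (hτ e))
      rw [h1]
      split_ifs with h
      · rw [h]
      · rw [(habs e).resolve_left h, solitonDeriv_neg]
    simp only [hde] at hsum
    rw [Finset.sum_ite, Finset.sum_const, Finset.sum_const, nsmul_eq_mul, nsmul_eq_mul] at hsum
    have hD := solitonDeriv_ne_zero hp hs0
    have h3 : (((Finset.univ.filter fun e => τ e = s).card : ℝ) -
        (Finset.univ.filter fun e => ¬τ e = s).card) * solitonDeriv p s = 0 := by linarith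
    have h4 := sub_eq_zero.1 ((mul_eq_zero.1 h3).resolve_right hD)
    rw [Finset.compl_filter]
    exact_mod_cast h4
  · intro x
    rw [hτ, (Finset.mem_filter.1 he).2]
  · intro x
    have h1 : τ e ≠ s := fun h => he (Finset.mem_filter.2 ⟨Finset.mem_univ _, h⟩)
    rw [hτ, (habs e).resolve_left h1, sub_eq_add_neg]

end Edge

theorem isSolution_iff_isPairedSoliton (hp : 2 < p) (hN : 1 ≤ N) (hev : Even N)
    (v : StarGraph N → ℝ) :
    (IsSolution p v ∧ (∀ x, 0 ≤ v x) ∧ v ≠ 0) ↔ IsPairedSoliton p v := by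
  constructor
  · rintro ⟨hv, hnn, hne⟩
    have hN1 : N ≠ 1 := by rintro rfl; exact absurd hev (by decide)
    obtain ⟨s, P, hsP, h₁, h₂⟩ := hv.exists_shift_and_set hp hN hN1 hnn hne
    rcases hsP with hs | hP
    -- For s = 0 all edges carry the same profile and P may have any size, so any partition into
    -- halves serves.
    · obtain ⟨Q, hQ⟩ := exists_card_eq_compl hev
      have h : ∀ e (x : ℝ≥0), v (pt e x) = soliton p x := by
        intro e x
        by_cases he : e ∈ P
        · rw [h₁ e he, hs, add_zero]
        · rw [h₂ e he, hs, sub_zero]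
      exact isPairedSoliton_of_card hQ (s := 0) (fun e _ x => by rw [h, add_zero])
        fun e _ x => by rw [h, sub_zero]
    · exact isPairedSoliton_of_card hP h₁ h₂
  · intro h
    refine ⟨h.isSolution hp, fun x => (h.pos hp x).le, fun hz => ?_⟩
    have := h.pos hp (pt ⟨0, hN⟩ 0)
    rw [hz] at this
    exact lt_irrefl _ this

theorem IsSolution.eq_soliton_of_odd (hp : 2 < p) (hodd : Odd N) (hN : 3 ≤ N)
    {v : StarGraph N → ℝ} (hv : IsSolution p v) (hnn : ∀ y, 0 ≤ v y) (hne : v ≠ 0)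
    (e : Fin N) (x : ℝ≥0) : v (pt e x) = soliton p x := by
  obtain ⟨s, P, hsP, h₁, h₂⟩ := hv.exists_shift_and_set hp (by omega) (by omega) hnn hne
  have hs : s = 0 := by
    refine hsP.resolve_right fun h => ?_
    have h1 := Finset.card_add_card_compl P
    rw [← h, Fintype.card_fin] at h1
    exact (Nat.not_even_iff_odd.2 hodd) ⟨_, h1.symm⟩
  by_cases he : e ∈ P
  · rw [h₁ e he, hs, add_zero]
  · rw [h₂ e he, hs, sub_zero]

end KirchhoffStar

end

/-! ### The theorem, case by case in the number of edges -/

open KirchhoffStar in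
theorem mainTheorem2 (p : ℝ) (hp : 2 < p) (N : ℕ) (hN : 1 ≤ N) :
    -- even number of edges
    (Even N →
      {v : StarGraph N → ℝ | IsSolution p v ∧ ∀ x, 0 < v x}.Infinite ∧
      (∀ v : StarGraph N → ℝ,
        (IsSolution p v ∧ (∀ x, 0 ≤ v x) ∧ v ≠ 0) ↔ IsPairedSoliton p v) ∧
      (∀ v : StarGraph N → ℝ, IsSolution p v → (∀ x, 0 ≤ v x) → v ≠ 0 →
        (IsMinimiser p v ↔ N = 2))) ∧
    -- one edge
    (N = 1 → ∀ v : StarGraph N → ℝ, IsSolution p v → v = 0) ∧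
    -- odd number of edges, at least three
    (Odd N → 3 ≤ N →
      ∃ v : StarGraph N → ℝ,
        (IsSolution p v ∧ (∀ x, 0 ≤ v x) ∧ v ≠ 0) ∧
        (∀ w : StarGraph N → ℝ, IsSolution p w → (∀ x, 0 ≤ w x) → w ≠ 0 → w = v) ∧
        (∀ e, v (pt e 0) = soliton p 0) ∧
        (∀ e, HasDerivWithinAt (onEdge v e) 0 (Ici 0) 0) ∧
        ¬ IsMinimiser p v) ∧
    -- minimisers and the best constant
    (N ≠ 2 → ¬ ∃ v : StarGraph N → ℝ, IsMinimiser p v) ∧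
    0 < lineConst p ∧
    starConst p N = lineConst p := by
  refine ⟨fun hev => ⟨infinite_positive_solutions hp hN hev,
    isSolution_iff_isPairedSoliton hp hN hev, fun v hv hnn hne => ⟨fun hm => ?_, ?_⟩⟩,
    fun h1 v hv => hv.eq_zero hp (hv.1.2.2 h1), fun hodd h3 => ?_,
    fun h2 ⟨v, hv⟩ => not_isMinimiser hp hN h2 v hv, ?_, ?_⟩
  · by_contra h2
    exact not_isMinimiser hp hN h2 v hm
  · rintro rfl
    exact ((isSolution_iff_isPairedSoliton hp hN hev v).1 ⟨hv, hnn, hne⟩).isMinimiser hp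
  · set v : StarGraph N → ℝ := glue (fun _ x => soliton p x) fun _ _ => rfl with hvdef
    have hv : ∀ e (x : NNReal), v (pt e x) = soliton p (x + (fun _ => 0) e) := fun e x => by
      rw [add_zero]; rfl
    refine ⟨v, ⟨isSolution_of_shifted hp (by omega) hv (by simp [solitonDeriv_zero]),
      fun y => ?_, fun hz => ?_⟩, fun w hw hnn hne => ?_, fun e => ?_, fun e => ?_,
      not_isMinimiser hp hN (by rintro rfl; omega) v⟩
    · obtain ⟨e, x, rfl⟩ := exists_eq_pt y
      rw [hv]
      exact (soliton_pos hp _).le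
    · have h := hv ⟨0, hN⟩ 0
      rw [hz] at h
      exact (soliton_pos hp _).ne h
    · funext y
      obtain ⟨e, x, rfl⟩ := exists_eq_pt y
      rw [hw.eq_soliton_of_odd hp hodd h3 hnn hne, hv, add_zero]
    · rw [hv]
      simp
    · have h := hasDerivWithinAt_of_shifted hp (τ := fun _ => 0) (hv e)
      rwa [solitonDeriv_zero] at h
  · rw [lineConst_eq hp]
    exact inv_pos.2 (sobolevInf_pos hp)
  · rw [lineConst_eq hp, starConst_eq hp hN]
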